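/- Let $E,F$ be real Hausdorff locally convex vector spaces and let $k\in\mathbb N\cup\{\infty\}$. Let $V\subseteq E$ be non-empty and open, and let $V\subseteq \breve V\subseteq \overline V$. All differentiability is in the sense of Bastiani. That is, for $U$ open in a locally convex space $H$, a map $f\colon U\to F$ is of class $C^k$ if the iterated directional derivatives $\mathrm d^\ell f(x,v_1,\dots,v_\ell)=D_{v_\ell}(\cdots(D_{v_1}f)\cdots)(x)$ exist and $\mathrm d^\ell f\colon U\times H^\ell\to F$ is continuous for all finite $0\le\ell\le k$ (with $\mathrm d^0f=f$). If moreover $U\neq\emptyset$ and $U\subseteq \breve U\subseteq\overline U$, let $\mathcal C^k_{\breve U}(U,F)$ denote the vector space of all $f\in C^k(U,F)$ such that, for each finite $0\le\ell\le k$, $\mathrm d^\ell f$ extends to a (necessarily unique) continuous map $\mathrm{Ext}(f,\ell)\colon\breve U\times H^\ell\to F$. Let $n\ge1$, and for $i=1,\dots,n$ let $a_i\in[-\infty,\infty)$ and $\tau_i,b_i\in\mathbb R$ with $a_i<\tau_i<b_i$. In $H:=\mathbb R^n\times E$ we put $$\mathcal C^k_{\breve V}\Big(\prod_{i=1}^n(a_i,b_i)\times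 V,F\Big):=\mathcal C^k_{\prod_i(a_i,b_i]\times\breve V}\Big(\prod_{i=1}^n(a_i,b_i)\times V,F\Big),\qquad \mathcal C^k_{\breve V}\Big(\prod_{i=1}^n(a_i,\infty)\times V,F\Big):=\mathcal C^k_{\prod_i(a_i,\infty)\times\breve V}\Big(\prod_{i=1}^n(a_i,\infty)\times V,F\Big).$$ Then there exists a linear map $$\mathcal E\colon \mathcal C^k_{\breve V}\Big(\prod_{i=1}^n(a_i,b_i)\times V,F\Big)\to \mathcal C^k_{\breve V}\Big(\prod_{i=1}^n(a_i,\infty)\times V,F\Big)$$ such that for every $f\in \mathcal C^k_{\breve V}\big(\prod_i(a_i,b_i)\times V,F\big)$ and every finite $0\le\ell\le k$: (a) $\mathrm{Ext}(\mathcal E(f),\ell)=\mathrm{Ext}(f,\ell)$ on $\prod_{i=1}^n(a_i,b_i]\times\breve V\times H^\ell$; (b) $\mathrm{Ext}(\mathcal E(f),\ell)=0$ on $\{y\}\times\breve V\times H^\ell$ for every $y=(y_1,\dots,y_n)\in\prod_{i=1}^n(a_i,\infty)$ with $y_i\ge 2b_i-\tau_i$ for some $1\le i\le n$. -/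

import Mathlib

open Set Filter Topology

noncomputable section

namespace Bastiani

section Calculus

variable {H F : Type*} [AddCommGroup H] [Module ℝ H] [TopologicalSpace H]
  [AddCommGroup F] [Module ℝ F] [TopologicalSpace F]

/-- `y` is the directional derivative `lim_{t → 0} t⁻¹ • (f (x + t • v) - f x)` of `f` at `x`
along `v`. -/
def HasDirDeriv (f : H → F) (x v : H) (y : F) : Prop :=
  Tendsto (fun t : ℝ => t⁻¹ • (f (x + t • v) - f x)) (𝓝[≠] 0) (𝓝 y)

/-- The value `D_v f (x)` (meaningful if the directional derivative exists). -/
def dirDeriv (f : H → F) (x v : H) : F :=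
  limUnder (𝓝[≠] (0 : ℝ)) (fun t : ℝ => t⁻¹ • (f (x + t • v) - f x))

/-- The `p`-th differential `d^p f (x, v_1, …, v_p) = D_{v_p} (⋯ (D_{v_1} f) ⋯) (x)`, with
`d^0 f = f`. The vector `v_j` is `v (j - 1)`; the last derivative taken is the one along the last
vector. -/
def differential (f : H → F) : (p : ℕ) → H → (Fin p → H) → F
  | 0, x, _ => f x
  | p + 1, x, v => dirDeriv (fun z => differential f p z (Fin.init v)) x (v (Fin.last p))

/-- `f` is of class `C^k` on the (open) set `U` in the sense of Bastiani: all iterated directional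
derivatives of order at most `k` exist on `U`, and `d^p f` is continuous on `U × H^p` for every
finite `p ≤ k`. -/
structure IsCk (k : ℕ∞) (U : Set H) (f : H → F) : Prop where
  differentiable : ∀ p : ℕ, (p : ℕ∞) < k → ∀ v : Fin p → H, ∀ x ∈ U, ∀ w : H,
    ∃ y : F, HasDirDeriv (fun z => differential f p z v) x w y
  continuousOn : ∀ p : ℕ, (p : ℕ∞) ≤ k →
    ContinuousOn (fun z : H × (Fin p → H) => differential f p z.1 z.2) (U ×ˢ univ)

/-- `Φ` restricted to `CU × H^ℓ` is a continuous extension of `d^ℓ f : U × H^ℓ → F`. -/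
structure IsExt (U CU : Set H) (f : H → F) (ℓ : ℕ) (Φ : H → (Fin ℓ → H) → F) : Prop where
  continuousOn : ContinuousOn (fun z : H × (Fin ℓ → H) => Φ z.1 z.2) (CU ×ˢ univ)
  eq : ∀ x ∈ U, ∀ v : Fin ℓ → H, Φ x v = differential f ℓ x v

set_option linter.unusedSectionVars false
set_option linter.unusedVariables false

theorem HasDirDeriv.dirDeriv_eq [T2Space F] {f : H → F} {x v : H} {y : F}
    (h : HasDirDeriv f x v y) : dirDeriv f x v = y :=
  h.limUnder_eq

theorem HasDirDeriv.congr [ContinuousAdd H] [ContinuousSMul ℝ H] {U : Set H} (hU : IsOpen U)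
    {f g : H → F} {x v : H} {y : F} (hx : x ∈ U) (hfg : EqOn f g U)
    (h : HasDirDeriv f x v y) : HasDirDeriv g x v y := by
  have hc : Tendsto (fun t : ℝ => x + t • v) (𝓝[≠] 0) (𝓝 x) := by
    have h1 : Continuous (fun t : ℝ => x + t • v) := by fun_prop
    have h2 := h1.tendsto 0
    rw [zero_smul, add_zero] at h2
    exact h2.mono_left nhdsWithin_le_nhds
  refine Tendsto.congr' ?_ h
  filter_upwards [hc.eventually (hU.mem_nhds hx)] with t ht
  rw [hfg ht, hfg hx]

theorem HasDirDeriv.add [ContinuousAdd F] {f g : H → F} {x v : H} {y z : F}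
    (hf : HasDirDeriv f x v y) (hg : HasDirDeriv g x v z) :
    HasDirDeriv (fun u => f u + g u) x v (y + z) := by
  refine (Tendsto.add hf hg).congr fun t => ?_
  rw [← smul_add, add_sub_add_comm]

theorem HasDirDeriv.const_smul [ContinuousConstSMul ℝ F] {f : H → F} {x v : H} {y : F} (c : ℝ)
    (hf : HasDirDeriv f x v y) : HasDirDeriv (fun u => c • f u) x v (c • y) := by
  refine (Tendsto.const_smul hf c).congr fun t => ?_
  rw [smul_comm, smul_sub]

theorem IsCk.hasDirDeriv [T2Space F] {k : ℕ∞} {U : Set H} {f : H → F} (hf : IsCk k U f) {p : ℕ}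
    (hp : (p : ℕ∞) < k) {x : H} (hx : x ∈ U) (v : Fin p → H) (w : H) :
    HasDirDeriv (fun z => differential f p z v) x w
      (dirDeriv (fun z => differential f p z v) x w) := by
  obtain ⟨y, hy⟩ := hf.differentiable p hp v x hx w
  rwa [hy.dirDeriv_eq]

section Linear

variable [ContinuousAdd H] [ContinuousSMul ℝ H] [T2Space F]

theorem IsCk.differential_add [ContinuousAdd F] {k : ℕ∞} {U : Set H} (hU : IsOpen U)
    {f g : H → F} (hf : IsCk k U f) (hg : IsCk k U g) : ∀ p : ℕ, (p : ℕ∞) ≤ k → ∀ x ∈ U,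
      ∀ v : Fin p → H, differential (f + g) p x v = differential f p x v + differential g p x v
  | 0, _, _, _, _ => rfl
  | p + 1, hp, x, hx, v => by
    have hp' : (p : ℕ∞) < k := lt_of_lt_of_le (by exact_mod_cast Nat.lt_succ_self p) hp
    have key := (hf.hasDirDeriv hp' hx (Fin.init v) (v (Fin.last p))).add
      (hg.hasDirDeriv hp' hx (Fin.init v) (v (Fin.last p)))
    exact (key.congr hU hx fun z hz =>
      (hf.differential_add hU hg p hp'.le z hz (Fin.init v)).symm).dirDeriv_eq

theorem IsCk.differential_smul [ContinuousConstSMul ℝ F] {k : ℕ∞} {U : Set H} (hU : IsOpen U)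
    {f : H → F} (hf : IsCk k U f) (c : ℝ) : ∀ p : ℕ, (p : ℕ∞) ≤ k → ∀ x ∈ U,
      ∀ v : Fin p → H, differential (c • f) p x v = c • differential f p x v
  | 0, _, _, _, _ => rfl
  | p + 1, hp, x, hx, v => by
    have hp' : (p : ℕ∞) < k := lt_of_lt_of_le (by exact_mod_cast Nat.lt_succ_self p) hp
    have key := (hf.hasDirDeriv hp' hx (Fin.init v) (v (Fin.last p))).const_smul c
    exact (key.congr hU hx fun z hz =>
      (hf.differential_smul hU c p hp'.le z hz (Fin.init v)).symm).dirDeriv_eq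

theorem IsCk.add [ContinuousAdd F] {k : ℕ∞} {U : Set H} (hU : IsOpen U)
    {f g : H → F} (hf : IsCk k U f) (hg : IsCk k U g) : IsCk k U (f + g) where
  differentiable p hp v x hx w :=
    ⟨_, ((hf.hasDirDeriv hp hx v w).add (hg.hasDirDeriv hp hx v w)).congr hU hx
      fun z hz => (hf.differential_add hU hg p hp.le z hz v).symm⟩
  continuousOn p hp := ((hf.continuousOn p hp).add (hg.continuousOn p hp)).congr
    fun z hz => hf.differential_add hU hg p hp z.1 hz.1 z.2

theorem IsCk.const_smul [ContinuousConstSMul ℝ F] {k : ℕ∞} {U : Set H} (hU : IsOpen U)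
    {f : H → F} (hf : IsCk k U f) (c : ℝ) : IsCk k U (c • f) where
  differentiable p hp v x hx w :=
    ⟨_, ((hf.hasDirDeriv hp hx v w).const_smul c).congr hU hx
      fun z hz => (hf.differential_smul hU c p hp.le z hz v).symm⟩
  continuousOn p hp := ((hf.continuousOn p hp).const_smul c).congr
    fun z hz => hf.differential_smul hU c p hp z.1 hz.1 z.2

end Linear

theorem differential_zero : ∀ (p : ℕ) (x : H) (v : Fin p → H) [T2Space F],
    differential (0 : H → F) p x v = 0
  | 0, _, _, _ => rfl
  | p + 1, x, v, _ => by
    refine HasDirDeriv.dirDeriv_eq (tendsto_const_nhds.congr fun t => ?_)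
    simp [differential_zero p]

theorem isCk_zero [T2Space F] (k : ℕ∞) (U : Set H) : IsCk k U (0 : H → F) where
  differentiable p _ v x _ w := ⟨0, tendsto_const_nhds.congr fun t => by
    simp [differential_zero p]⟩
  continuousOn p _ := (continuousOn_const (c := (0 : F))).congr
    fun z _ => differential_zero p z.1 z.2

end Calculus

/-- The pairs `(U, CU)` with `U` non-empty and open, and `U ⊆ CU ⊆ closure U`. -/
structure DomainPair (H : Type*) [TopologicalSpace H] where
  /-- the open set -/
  U : Set H
  /-- the set in between `U` and its closure -/
  CU : Set H
  isOpen : IsOpen U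
  nonempty : U.Nonempty
  subset : U ⊆ CU
  subset_closure : CU ⊆ closure U

/-- The product pair `(W × V, CW × CV)`. -/
def DomainPair.prod {P E : Type*} [TopologicalSpace P] [TopologicalSpace E]
    (A : DomainPair P) (B : DomainPair E) : DomainPair (P × E) where
  U := A.U ×ˢ B.U
  CU := A.CU ×ˢ B.CU
  isOpen := A.isOpen.prod B.isOpen
  nonempty := A.nonempty.prod B.nonempty
  subset := prod_mono A.subset B.subset
  subset_closure := by
    rw [closure_prod_eq]
    exact prod_mono A.subset_closure B.subset_closure

section MappingSpace

variable {H : Type*} (F : Type*) [AddCommGroup H] [Module ℝ H] [TopologicalSpace H]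
  [ContinuousAdd H] [ContinuousSMul ℝ H]
  [AddCommGroup F] [Module ℝ F] [TopologicalSpace F] [ContinuousAdd F] [ContinuousSMul ℝ F]
  [T2Space F]

/-- A map `f : U → F` viewed as a map on the whole space (with value `0` outside of `U`). Since `U`
is open, this does not affect the differentials on `U`. -/
def DomainPair.lift {F : Type*} [Zero F] (A : DomainPair H) (f : A.U → F) : H → F :=
  Function.extend Subtype.val f 0

/-- The space `𝒞^k_{CU}(U, F)` of all maps `f : U → F` of class `C^k` such that `d^ℓ f` extends,
for every finite `ℓ ≤ k`, to a continuous map `CU × H^ℓ → F`. -/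
def CkExt (k : ℕ∞) (A : DomainPair H) : Submodule ℝ (A.U → F) where
  carrier := {f | IsCk k A.U (A.lift f) ∧ ∀ ℓ : ℕ, (ℓ : ℕ∞) ≤ k →
    ∃ Φ : H → (Fin ℓ → H) → F, IsExt A.U A.CU (A.lift f) ℓ Φ}
  add_mem' := by
    intro f g hf hg
    have hfg : A.lift (f + g) = A.lift f + A.lift g := by
      simpa [DomainPair.lift] using Function.extend_add (Subtype.val) f g 0 0
    rw [mem_ofPred_eq, hfg]
    refine ⟨hf.1.add A.isOpen hg.1, fun ℓ hℓ => ?_⟩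
    obtain ⟨Φ, hΦ⟩ := hf.2 ℓ hℓ
    obtain ⟨Ψ, hΨ⟩ := hg.2 ℓ hℓ
    refine ⟨fun x v => Φ x v + Ψ x v, hΦ.continuousOn.add hΨ.continuousOn, fun x hx v => ?_⟩
    rw [hf.1.differential_add A.isOpen hg.1 ℓ hℓ x hx v, hΦ.eq x hx v, hΨ.eq x hx v]
  zero_mem' := by
    have h0 : A.lift (0 : A.U → F) = 0 := Function.extend_zero _
    rw [mem_ofPred_eq, h0]
    exact ⟨isCk_zero k A.U, fun ℓ _ => ⟨0, continuousOn_const,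
      fun x _ v => (differential_zero ℓ x v).symm⟩⟩
  smul_mem' := by
    intro c f hf
    have hcf : A.lift (c • f) = c • A.lift f := by
      simpa [DomainPair.lift] using Function.extend_smul c (Subtype.val) f 0
    rw [mem_ofPred_eq, hcf]
    refine ⟨hf.1.const_smul A.isOpen c, fun ℓ hℓ => ?_⟩
    obtain ⟨Φ, hΦ⟩ := hf.2 ℓ hℓ
    refine ⟨fun x v => c • Φ x v, hΦ.continuousOn.const_smul c, fun x hx v => ?_⟩
    rw [hf.1.differential_smul A.isOpen c ℓ hℓ x hx v, hΦ.eq x hx v]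

variable {F}

open Classical in
/-- The extended differential `ext f ℓ : CU × H^ℓ → F` of `f ∈ 𝒞^k_{CU}(U, F)`, for `ℓ ≤ k`: the
continuous extension of `d^ℓ f` to `CU × H^ℓ`. On this set it is uniquely determined, see `ext_spec`
and `eqOn_of_isExt`; its values elsewhere have no meaning. -/
def CkExt.ext {k : ℕ∞} {A : DomainPair H} (f : CkExt F k A) (ℓ : ℕ) (x : H) (v : Fin ℓ → H) : F :=
  if h : ∃ Φ : H → (Fin ℓ → H) → F, IsExt A.U A.CU (A.lift (f : A.U → F)) ℓ Φ
    then h.choose x v else 0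

theorem CkExt.ext_spec {k : ℕ∞} {A : DomainPair H} (f : CkExt F k A) {ℓ : ℕ}
    (hℓ : (ℓ : ℕ∞) ≤ k) : IsExt A.U A.CU (A.lift (f : A.U → F)) ℓ (CkExt.ext f ℓ) := by
  have h := f.2.2 ℓ hℓ
  have h2 : CkExt.ext f ℓ = h.choose := by
    funext x v
    simp only [CkExt.ext, dif_pos h]
  rw [h2]
  exact h.choose_spec

theorem CkExt.eqOn_of_isExt {k : ℕ∞} {A : DomainPair H} (f : CkExt F k A) {ℓ : ℕ}
    (hℓ : (ℓ : ℕ∞) ≤ k) {Φ : H → (Fin ℓ → H) → F}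
    (hΦ : IsExt A.U A.CU (A.lift (f : A.U → F)) ℓ Φ) {x : H} (hx : x ∈ A.CU) (v : Fin ℓ → H) :
    CkExt.ext f ℓ x v = Φ x v := by
  have hs := CkExt.ext_spec f hℓ
  have key : EqOn (fun z : H × (Fin ℓ → H) => CkExt.ext f ℓ z.1 z.2)
      (fun z : H × (Fin ℓ → H) => Φ z.1 z.2) (A.CU ×ˢ univ) := by
    refine EqOn.of_subset_closure (s := A.U ×ˢ univ) ?_ hs.continuousOn hΦ.continuousOn
      (prod_mono A.subset subset_rfl) ?_
    · intro z hz
      exact (hs.eq z.1 hz.1 z.2).trans (hΦ.eq z.1 hz.1 z.2).symm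
    · rw [closure_prod_eq, closure_univ]
      exact prod_mono A.subset_closure subset_rfl
  exact key (x := (x, v)) ⟨hx, mem_univ _⟩

end MappingSpace

section Cube

variable {n : ℕ}

/-- The open cube `(a_1, b_1) × ⋯ × (a_n, b_n)` in `ℝ^n`, with extended real end points. -/
def cube (a b : Fin n → EReal) : Set (Fin n → ℝ) :=
  univ.pi fun i => {y : ℝ | a i < (y : EReal) ∧ (y : EReal) < b i}

/-- The half-closed cube `(a_1, b_1] × ⋯ × (a_n, b_n]` in `ℝ^n`, where `(a_i, b_i] = (a_i, ∞)` if
`b_i = ∞`. -/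
def cubec (a b : Fin n → EReal) : Set (Fin n → ℝ) :=
  univ.pi fun i => {y : ℝ | a i < (y : EReal) ∧ (y : EReal) ≤ b i}

/-- The pair of the open and the half-closed cube. -/
def cubePair (a b : Fin n → EReal) (h : ∀ i, a i < b i) : DomainPair (Fin n → ℝ) where
  U := cube a b
  CU := cubec a b
  isOpen := isOpen_set_pi finite_univ fun i _ =>
    (isOpen_lt continuous_const continuous_coe_real_ereal).inter
      (isOpen_lt continuous_coe_real_ereal continuous_const)
  nonempty := univ_pi_nonempty_iff.2 fun i => by
    obtain ⟨y, hy⟩ := EReal.lt_iff_exists_real_btwn.1 (h i)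
    exact ⟨y, hy⟩
  subset := pi_mono fun i _ y hy => ⟨hy.1, hy.2.le⟩
  subset_closure := by
    rw [cube, closure_pi_set]
    refine pi_mono fun i _ y hy => ?_
    obtain ⟨c, hac, hcy⟩ := EReal.lt_iff_exists_real_btwn.1 hy.1
    have hcy' : c < y := EReal.coe_lt_coe_iff.1 hcy
    have hsub : Ioo c y ⊆ {y : ℝ | a i < (y : EReal) ∧ (y : EReal) < b i} := fun t ht =>
      ⟨hac.trans (EReal.coe_lt_coe_iff.2 ht.1), (EReal.coe_lt_coe_iff.2 ht.2).trans_le hy.2⟩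
    refine closure_mono hsub ?_
    rw [closure_Ioo hcy'.ne]
    exact ⟨hcy'.le, le_rfl⟩

end Cube

end Bastiani

end

/-!
# Extension of `C^k`-maps in the sense of Bastiani across the faces of a cube

The extension is built by Seeley's reflection method, one coordinate at a time. Working in a space
`H = ℝ^n × E`, let `lam : H → ℝ` be a coordinate of `ℝ^n` with coordinate vector `e`, and let `f` be
defined for `lam < b`. With a smooth cutoff function `χ` that is `1` near `b` and `0` near `τ`, put
`f̃ = (χ ∘ lam) • f` and, for `lam z > b`,
`E f (z) = ∑ j, c j • f̃ (T_j z)`, where `T_j z = z - (1 + 2 ^ j) * (lam z - b) • e`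
scales the distance to the hyperplane `lam = b` by `- 2 ^ j`. Because of the cutoff, the sum is
finite locally on `lam > b`, so that no completeness of `F` is needed, and it vanishes for
`lam z ≥ 2 * b - τ`. The coefficients satisfy `∑ j, c j * (2 ^ j) ^ m = (-1) ^ m` for all `m`, with
absolute convergence (`exists_reflection_coeff`); they are obtained as limits of the coefficients
of Lagrange interpolation at `-1`.

The differentials of `f` are handled as a family `Φ ℓ : CU × H^ℓ → F` of continuous maps linked by
directional derivatives (`IsJet`); such families describe the space `𝒞^k_{CU}(U, F)` completely
(`CkExt.isJet`, `IsJet.mem_ckExt`). The `ℓ`-th differential of `E f` at `z` with `lam z > b` is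
`∑ j, c j • Φ̃ ℓ (T_j z) (L_j v_1, …, L_j v_ℓ)`, where the linear part `L_j` of `T_j` is affine in
`2 ^ j`. As `Φ̃ ℓ z` is multilinear (`IsJet.exists_multilinearMap`), each summand is, at the
hyperplane, a polynomial in `2 ^ j` times `c j`, and the moment conditions make the sum equal to
`Φ ℓ z v` there (`IsReflectable.hasSum_reflectTerm`). Dominated convergence with respect to every
continuous seminorm of `F` (`IsReflectable.exists_seminorm_reflectTerm_le`,
`tendsto_tsum_of_seminorm_le`) then gives continuity of the differentials across the hyperplane, and
the mean value inequality shows that they are differentials on the hyperplane, too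
(`HasDirDeriv.of_off_hyperplane`).

Reflecting in one coordinate moves points only in this coordinate. Hence the vanishing of an
extension where one coordinate is large persists in the later steps
(`IsReflectable.exists_extension`, `exists_extension_cubePair`). The two assertions about extended
differentials finally follow from those about values by density, see `IsJet.eq_of_eq_zero`.
-/

open scoped ContDiff

noncomputable section

namespace Bastiani

/-! ### Directional derivatives and the mean value inequality -/

section Calculus

variable {H F : Type*} [AddCommGroup H] [Module ℝ H] [TopologicalSpace H]
  [AddCommGroup F] [Module ℝ F] [TopologicalSpace F]

omit [TopologicalSpace H] in
theorem HasDirDeriv.unique [T2Space F] {f : H → F} {x v : H} {y z : F}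
    (hy : HasDirDeriv f x v y) (hz : HasDirDeriv f x v z) : y = z :=
  tendsto_nhds_unique hy hz

omit [TopologicalSpace H] in
theorem HasDirDeriv.smul_dir [ContinuousConstSMul ℝ F] {f : H → F} {x v : H} {y : F}
    (h : HasDirDeriv f x v y) (c : ℝ) : HasDirDeriv f x (c • v) (c • y) := by
  rcases eq_or_ne c 0 with rfl | hc
  · simpa [HasDirDeriv] using tendsto_const_nhds
  · have h1 : Tendsto (fun t : ℝ => t * c) (𝓝[≠] 0) (𝓝[≠] 0) := by
      refine tendsto_nhdsWithin_iff.2 ⟨?_, ?_⟩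
      · have : Tendsto (fun t : ℝ => t * c) (𝓝 0) (𝓝 (0 * c)) := tendsto_id.mul_const c
        rw [zero_mul] at this
        exact this.mono_left nhdsWithin_le_nhds
      · filter_upwards [self_mem_nhdsWithin] with t ht
        exact mul_ne_zero ht hc
    refine (Tendsto.const_smul (h.comp h1) c).congr fun t => ?_
    simp only [Function.comp, smul_smul, mul_inv]
    congr 1
    field_simp

omit [TopologicalSpace H] in
/-- The chain rule for an affine inner map, in the form `A (x + t • v) = A x + t • w`. -/
theorem HasDirDeriv.comp_affine {H' : Type*} [AddCommGroup H'] [Module ℝ H']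
    [TopologicalSpace H'] {f : H → F} {A : H' → H} {x v : H'} {w : H} {y : F}
    (hA : ∀ t : ℝ, A (x + t • v) = A x + t • w) (h : HasDirDeriv f (A x) w y) :
    HasDirDeriv (fun z => f (A z)) x v y := by
  simpa only [HasDirDeriv, hA] using h

theorem tendsto_add_smul_nhdsNE [ContinuousAdd H] [ContinuousSMul ℝ H] (x v : H) :
    Tendsto (fun t : ℝ => x + t • v) (𝓝[≠] 0) (𝓝 x) := by
  have h1 : Continuous (fun t : ℝ => x + t • v) := by fun_prop
  have h2 := h1.tendsto 0
  rw [zero_smul, add_zero] at h2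
  exact h2.mono_left nhdsWithin_le_nhds

/-- The product rule for a scalar factor that depends on a linear functional only. -/
theorem HasDirDeriv.smul_comp_clm [ContinuousAdd H] [ContinuousSMul ℝ H] [ContinuousAdd F]
    [ContinuousSMul ℝ F] (lam : H →L[ℝ] ℝ) {χ : ℝ → ℝ} {χ' : ℝ} {f : H → F} {x v : H} {y : F}
    (hχ : HasDerivAt χ χ' (lam x)) (hf : HasDirDeriv f x v y)
    (hfc : Tendsto (fun t : ℝ => f (x + t • v)) (𝓝[≠] 0) (𝓝 (f x))) :
    HasDirDeriv (fun z => χ (lam z) • f z) x v ((lam v * χ') • f x + χ (lam x) • y) := by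
  have h1 : HasDerivAt (fun t : ℝ => χ (lam x + t * lam v)) (lam v * χ') 0 := by
    have h2 : HasDerivAt (fun t : ℝ => lam x + t * lam v) (lam v) 0 := by
      simpa using ((hasDerivAt_id (0 : ℝ)).mul_const (lam v)).const_add (lam x)
    have h3 : HasDerivAt χ χ' (lam x + 0 * lam v) := by simpa using hχ
    simpa [mul_comm, Function.comp_def] using h3.comp (0 : ℝ) h2
  rw [hasDerivAt_iff_tendsto_slope_zero] at h1
  refine ((h1.smul hfc).add (Tendsto.const_smul hf (χ (lam x)))).congr fun t => ?_
  simp only [zero_add, zero_mul, add_zero, map_add, map_smul, smul_eq_mul, smul_sub, smul_smul,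
    sub_smul, mul_sub]
  rw [mul_comm (χ (lam x)) t⁻¹]
  abel

theorem exists_add_smul_add_smul_mem [ContinuousAdd H] [ContinuousSMul ℝ H] {x : H} {N : Set H}
    (hN : N ∈ 𝓝 x) (v w : H) :
    ∃ δ > 0, ∀ t s : ℝ, |t| < δ → |s| < δ → x + t • v + s • w ∈ N := by
  have hc : Continuous fun p : ℝ × ℝ => x + p.1 • v + p.2 • w := by fun_prop
  have h0 := hc.tendsto (0, 0)
  simp only [zero_smul, add_zero] at h0
  obtain ⟨δ, hδ, h⟩ := Metric.mem_nhds_iff.1 (h0 hN)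
  refine ⟨δ, hδ, fun t s ht hs => h (a := (t, s)) ?_⟩
  simpa [Prod.dist_eq] using And.intro ht hs

variable [IsTopologicalAddGroup F] [ContinuousSMul ℝ F] [LocallyConvexSpace ℝ F]

omit [TopologicalSpace H] in
/-- The mean value inequality along a segment. If it failed, the Hahn–Banach theorem would give a
continuous functional separating the increment from the closed convex set `{u | q (u - y) ≤ C}`,
against the mean value theorem for the composition with this functional. -/
theorem seminorm_sub_le_of_hasDirDeriv {q : Seminorm ℝ F} (hq : Continuous q) {f : H → F}
    {x w : H} {y : F} {f' : ℝ → F} {C : ℝ}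
    (h : ∀ r ∈ Icc (0 : ℝ) 1, HasDirDeriv f (x + r • w) w (f' r))
    (hC : ∀ r ∈ Icc (0 : ℝ) 1, q (f' r - y) ≤ C) : q (f (x + w) - f x - y) ≤ C := by
  by_contra hlt
  have hconv : Convex ℝ {u : F | q (u - y) ≤ C} := by
    have : {u : F | q (u - y) ≤ C} = q.closedBall y C := by
      ext u; simp [Seminorm.mem_closedBall]
    rw [this]
    exact q.convex_closedBall y C
  have hclosed : IsClosed {u : F | q (u - y) ≤ C} :=
    isClosed_le (hq.comp (continuous_id.sub continuous_const)) continuous_const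
  obtain ⟨φ, u, hφ, hu⟩ := geometric_hahn_banach_closed_point hconv hclosed
    (x := f (x + w) - f x) hlt
  have hd : ∀ r ∈ Icc (0 : ℝ) 1, HasDerivAt (fun s : ℝ => φ (f (x + s • w))) (φ (f' r)) r := by
    intro r hr
    rw [hasDerivAt_iff_tendsto_slope_zero]
    refine ((φ.continuous.tendsto _).comp (h r hr)).congr fun t => ?_
    simp only [Function.comp, map_smul, map_sub, add_smul, add_assoc]
  obtain ⟨r, hr, hr'⟩ := exists_hasDerivAt_eq_slope (fun s : ℝ => φ (f (x + s • w)))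
    (fun r => φ (f' r)) one_pos (fun r hr => (hd r hr).continuousAt.continuousWithinAt)
    (fun r hr => hd r ⟨hr.1.le, hr.2.le⟩)
  have h2 := hφ (f' r) (hC r ⟨hr.1.le, hr.2.le⟩)
  simp only [one_smul, zero_smul, add_zero, sub_zero, div_one] at hr'
  rw [hr', ← map_sub] at h2
  exact lt_asymm h2 hu

omit [TopologicalSpace H] in
theorem seminorm_slope_sub_le {q : Seminorm ℝ F} (hq : Continuous q) {f D : H → F}
    {x w : H} {y : F} {C t : ℝ} (ht : t ≠ 0)
    (h : ∀ r ∈ Icc (0 : ℝ) 1, HasDirDeriv f (x + (r * t) • w) w (D (x + (r * t) • w)))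
    (hC : ∀ r ∈ Icc (0 : ℝ) 1, q (D (x + (r * t) • w) - y) ≤ C) :
    q (t⁻¹ • (f (x + t • w) - f x) - y) ≤ C := by
  have key : q (f (x + t • w) - f x - t • y) ≤ |t| * C := by
    refine seminorm_sub_le_of_hasDirDeriv hq
      (f' := fun r => t • D (x + (r * t) • w)) (fun r hr => ?_) (fun r hr => ?_)
    · rw [smul_smul]
      exact (h r hr).smul_dir t
    · rw [← smul_sub, map_smul_eq_mul, Real.norm_eq_abs]
      exact mul_le_mul_of_nonneg_left (hC r hr) (abs_nonneg t)
  have h2 : t⁻¹ • (f (x + t • w) - f x) - y = t⁻¹ • (f (x + t • w) - f x - t • y) := by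
    rw [smul_sub _ _ (t • y), smul_smul, inv_mul_cancel₀ ht, one_smul]
  rw [h2, map_smul_eq_mul, Real.norm_eq_abs, abs_inv]
  have h3 : 0 < |t| := abs_pos.2 ht
  rw [inv_mul_le_iff₀ h3]
  exact key

/-- To check convergence in a locally convex space, continuous seminorms suffice. -/
theorem tendsto_of_seminorm {ι : Type*} {l : Filter ι} {u : ι → F} {y : F}
    (h : ∀ q : Seminorm ℝ F, Continuous q → ∀ ε > 0, ∀ᶠ i in l, q (u i - y) ≤ ε) :
    Tendsto u l (𝓝 y) := by
  have hw := with_gaugeSeminormFamily (𝕜 := ℝ) (E := F)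
  rw [hw.tendsto_nhds]
  intro i ε hε
  filter_upwards [h _ (hw.continuous_seminorm i) (ε / 2) (half_pos hε)] with j hj
  linarith

variable [ContinuousAdd H] [ContinuousSMul ℝ H]

/-- If the derivative in the direction `w` exists near `x` and is continuous at `x`, derivatives
at `x` are additive in the direction. -/
theorem HasDirDeriv.add_dir {f D : H → F} {x v w : H} {y : F} (hf : HasDirDeriv f x v y)
    (hD : ∀ᶠ z in 𝓝 x, HasDirDeriv f z w (D z)) (hDc : ContinuousAt D x) :
    HasDirDeriv f x (v + w) (y + D x) := by
  have key : Tendsto (fun t : ℝ => t⁻¹ • (f (x + t • v + t • w) - f (x + t • v)))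
      (𝓝[≠] 0) (𝓝 (D x)) := by
    refine tendsto_of_seminorm fun q hq ε hε => ?_
    have hN : ∀ᶠ z in 𝓝 x, q (D z - D x) < ε := by
      have h1 : Tendsto (fun z => q (D z - D x)) (𝓝 x) (𝓝 (q (D x - D x))) :=
        (hq.tendsto _).comp (hDc.sub continuousAt_const)
      rw [sub_self, map_zero] at h1
      exact h1.eventually (gt_mem_nhds hε)
    obtain ⟨δ, hδ, h⟩ := exists_add_smul_add_smul_mem (hD.and hN) v w
    have hδ' : ∀ᶠ t : ℝ in 𝓝[≠] 0, |t| < δ := by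
      refine mem_nhdsWithin_of_mem_nhds ?_
      simpa [Metric.ball, Real.dist_eq] using Metric.ball_mem_nhds (0 : ℝ) hδ
    filter_upwards [hδ', self_mem_nhdsWithin] with t ht ht0
    have hr : ∀ r ∈ Icc (0 : ℝ) 1, |r * t| < δ := fun r hr => by
      rw [abs_mul, abs_of_nonneg hr.1]
      exact (mul_le_of_le_one_left (abs_nonneg t) hr.2).trans_lt ht
    exact seminorm_slope_sub_le hq ht0 (fun r hr' => (h t (r * t) ht (hr r hr')).1)
      (fun r hr' => (h t (r * t) ht (hr r hr')).2.le)
  refine (Tendsto.add hf key).congr fun t => ?_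
  rw [← smul_add, smul_add t v w, ← add_assoc]
  congr 1
  abel

/-- A continuous map that has, off a hyperplane, derivatives in the direction `w` which extend
continuously to the hyperplane, has these derivatives on the hyperplane as well: a segment starting
on the hyperplane is a limit of parallel segments staying on one side. -/
theorem HasDirDeriv.of_off_hyperplane {f D : H → F} {U : Set H} (hU : IsOpen U)
    (lam : H →L[ℝ] ℝ) {e : H} (he : lam e = 1) {w x : H} (hx : x ∈ U)
    (hf : ContinuousOn f U) (hDc : ContinuousOn D U)
    (hD : ∀ z ∈ U, lam z ≠ lam x → HasDirDeriv f z w (D z)) : HasDirDeriv f x w (D x) := by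
  refine tendsto_of_seminorm fun q hq ε hε => ?_
  have hN : ∀ᶠ z in 𝓝 x, q (D z - D x) < ε := by
    have h1 : Tendsto (fun z => q (D z - D x)) (𝓝 x) (𝓝 (q (D x - D x))) :=
      (hq.tendsto _).comp ((hDc.continuousAt (hU.mem_nhds hx)).sub continuousAt_const)
    rw [sub_self, map_zero] at h1
    exact h1.eventually (gt_mem_nhds hε)
  obtain ⟨δ, hδ, h⟩ := exists_add_smul_add_smul_mem
    (Filter.inter_mem (hU.mem_nhds hx) hN) e w
  have hδ' : ∀ᶠ t : ℝ in 𝓝[≠] 0, |t| < δ := by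
    refine mem_nhdsWithin_of_mem_nhds ?_
    simpa [Metric.ball, Real.dist_eq] using Metric.ball_mem_nhds (0 : ℝ) hδ
  filter_upwards [hδ', self_mem_nhdsWithin] with t ht ht0
  have hr : ∀ r ∈ Icc (0 : ℝ) 1, |r * t| < δ := fun r hr => by
    rw [abs_mul, abs_of_nonneg hr.1]
    exact (mul_le_of_le_one_left (abs_nonneg t) hr.2).trans_lt ht
  -- the side of the hyperplane on which the parallel segments run
  obtain ⟨σ, hσ0, hσ⟩ : ∃ σ : ℝ, σ ≠ 0 ∧ 0 ≤ σ * (t * lam w) := by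
    rcases le_total 0 (t * lam w) with h0 | h0
    · exact ⟨1, one_ne_zero, by simpa using h0⟩
    · exact ⟨-1, by norm_num, by simpa using h0⟩
  have hlim : Tendsto (fun s : ℝ => s * σ) (𝓝[>] 0) (𝓝 0) := by
    have : Tendsto (fun s : ℝ => s * σ) (𝓝 0) (𝓝 (0 * σ)) := tendsto_id.mul_const σ
    rw [zero_mul] at this
    exact this.mono_left nhdsWithin_le_nhds
  have hsmall : ∀ᶠ s : ℝ in 𝓝[>] 0, |s * σ| < δ := by
    have := hlim.eventually (Metric.ball_mem_nhds (0 : ℝ) hδ)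
    simpa [Real.dist_eq] using this
  have hest : ∀ᶠ s : ℝ in 𝓝[>] 0,
      q (t⁻¹ • (f (x + (s * σ) • e + t • w) - f (x + (s * σ) • e)) - D x) ≤ ε := by
    filter_upwards [hsmall, self_mem_nhdsWithin] with s hs hs0
    refine seminorm_slope_sub_le (D := D) hq ht0 (fun r hr' => ?_)
      (fun r hr' => (h _ _ hs (hr r hr')).2.le)
    refine hD _ (h _ _ hs (hr r hr')).1 ?_
    simp only [map_add, map_smul, he, smul_eq_mul, mul_one]
    intro heq
    have h0 : s * σ + r * t * lam w = 0 := by linarith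
    have h1 : s * (σ * σ) + r * (σ * (t * lam w)) = 0 := by linear_combination σ * h0
    have h2 : 0 < s * (σ * σ) := mul_pos hs0 (mul_self_pos.2 hσ0)
    have h3 : 0 ≤ r * (σ * (t * lam w)) := mul_nonneg hr'.1 hσ
    linarith
  have hx0 : x + (0 : ℝ) • e = x := by simp
  have hcont : ∀ z : H, z ∈ U →
      Tendsto (fun s : ℝ => f (z + (s * σ) • e)) (𝓝[>] 0) (𝓝 (f z)) := by
    intro z hz
    have h1 : Tendsto (fun s : ℝ => z + (s * σ) • e) (𝓝[>] 0) (𝓝 (z + (0 : ℝ) • e)) :=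
      tendsto_const_nhds.add (hlim.smul_const e)
    rw [zero_smul, add_zero] at h1
    exact (hf.continuousAt (hU.mem_nhds hz)).tendsto.comp h1
  have hxt : x + t • w ∈ U := by simpa using (h 0 t (by simpa using hδ) ht).1
  have hlim2 : Tendsto (fun s : ℝ =>
      q (t⁻¹ • (f (x + (s * σ) • e + t • w) - f (x + (s * σ) • e)) - D x)) (𝓝[>] 0)
      (𝓝 (q (t⁻¹ • (f (x + t • w) - f x) - D x))) := by
    refine (hq.tendsto _).comp (Tendsto.sub ?_ tendsto_const_nhds)
    refine Tendsto.const_smul (Tendsto.sub ?_ (hcont x hx)) _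
    simpa only [add_right_comm] using hcont _ hxt
  exact le_of_tendsto hlim2 hest

end Calculus

/-! ### Jets -/

section Jet

variable {H F : Type*} [AddCommGroup H] [Module ℝ H] [TopologicalSpace H]
  [AddCommGroup F] [Module ℝ F] [TopologicalSpace F]

/-- `Φ` is the family of the extended differentials of a map of class `C^k` on `U`: the maps
`Φ ℓ : CU × H^ℓ → F` are continuous, and on `U` the directional derivatives of `Φ ℓ (·, v)` are
given by `Φ (ℓ + 1)`. In contrast to `IsCk`, the higher differentials are part of the data, so that
they can be manipulated by explicit formulas on all of `CU`. -/
structure IsJet (k : ℕ∞) (U CU : Set H) (Φ : (ℓ : ℕ) → H → (Fin ℓ → H) → F) : Prop where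
  continuousOn : ∀ ℓ : ℕ, (ℓ : ℕ∞) ≤ k →
    ContinuousOn (fun z : H × (Fin ℓ → H) => Φ ℓ z.1 z.2) (CU ×ˢ univ)
  hasDirDeriv : ∀ ℓ : ℕ, (ℓ : ℕ∞) < k → ∀ x ∈ U, ∀ (v : Fin ℓ → H) (w : H),
    HasDirDeriv (fun z => Φ ℓ z v) x w (Φ (ℓ + 1) x (Fin.snoc (α := fun _ => H) v w))

variable {k : ℕ∞} {U CU : Set H} {Φ Ψ : (ℓ : ℕ) → H → (Fin ℓ → H) → F}

theorem natCast_lt_of_succ_le {ℓ : ℕ} (h : ((ℓ + 1 : ℕ) : ℕ∞) ≤ k) : (ℓ : ℕ∞) < k :=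
  lt_of_lt_of_le (by exact_mod_cast Nat.lt_succ_self ℓ) h

theorem natCast_succ_le_of_lt {ℓ : ℕ} (h : (ℓ : ℕ∞) < k) : ((ℓ + 1 : ℕ) : ℕ∞) ≤ k := by
  push_cast
  exact Order.add_one_le_of_lt h

theorem IsJet.continuousOn_apply (hΦ : IsJet k U CU Φ) {ℓ : ℕ} (hℓ : (ℓ : ℕ∞) ≤ k)
    (v : Fin ℓ → H) : ContinuousOn (fun z => Φ ℓ z v) CU :=
  (hΦ.continuousOn ℓ hℓ).comp (f := fun z : H => (z, v)) (by fun_prop)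
    fun z hz => ⟨hz, mem_univ _⟩

theorem IsJet.mono (hΦ : IsJet k U CU Φ) {U' CU' : Set H} (hU : U' ⊆ U) (hCU : CU' ⊆ CU) :
    IsJet k U' CU' Φ where
  continuousOn ℓ hℓ := (hΦ.continuousOn ℓ hℓ).mono (prod_mono hCU subset_rfl)
  hasDirDeriv ℓ hℓ x hx := hΦ.hasDirDeriv ℓ hℓ x (hU hx)

theorem isJet_zero (k : ℕ∞) (U CU : Set H) :
    IsJet k U CU (fun ℓ (_ : H) (_ : Fin ℓ → H) => (0 : F)) where
  continuousOn _ _ := continuousOn_const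
  hasDirDeriv _ _ x _ _ w := tendsto_const_nhds.congr fun t => by simp

theorem IsJet.add [ContinuousAdd F] (hΦ : IsJet k U CU Φ) (hΨ : IsJet k U CU Ψ) :
    IsJet k U CU (fun ℓ x v => Φ ℓ x v + Ψ ℓ x v) where
  continuousOn ℓ hℓ := (hΦ.continuousOn ℓ hℓ).add (hΨ.continuousOn ℓ hℓ)
  hasDirDeriv ℓ hℓ x hx v w := (hΦ.hasDirDeriv ℓ hℓ x hx v w).add (hΨ.hasDirDeriv ℓ hℓ x hx v w)

theorem IsJet.const_smul [ContinuousConstSMul ℝ F] (hΦ : IsJet k U CU Φ) (c : ℝ) :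
    IsJet k U CU (fun ℓ x v => c • Φ ℓ x v) where
  continuousOn ℓ hℓ := (hΦ.continuousOn ℓ hℓ).const_smul c
  hasDirDeriv ℓ hℓ x hx v w := (hΦ.hasDirDeriv ℓ hℓ x hx v w).const_smul c

theorem IsJet.sum [ContinuousAdd F] {ι : Type*} (s : Finset ι)
    {Θ : ι → (ℓ : ℕ) → H → (Fin ℓ → H) → F} (h : ∀ i ∈ s, IsJet k U CU (Θ i)) :
    IsJet k U CU (fun ℓ x v => ∑ i ∈ s, Θ i ℓ x v) := by
  classical
  induction s using Finset.induction_on with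
  | empty => simpa using isJet_zero k U CU
  | insert i s hi ih =>
    simp only [Finset.sum_insert hi]
    exact (h i (Finset.mem_insert_self i s)).add
      (ih fun j hj => h j (Finset.mem_insert_of_mem hj))

theorem IsJet.comp_affine (hΦ : IsJet k U CU Φ) {U' CU' : Set H} {T : H → H}
    (hT : Continuous T) (L : H →L[ℝ] H) (hTL : ∀ (x v : H) (t : ℝ), T (x + t • v) = T x + t • L v)
    (hU : MapsTo T U' U) (hCU : MapsTo T CU' CU) :
    IsJet k U' CU' (fun ℓ x v => Φ ℓ (T x) (L ∘ v)) where
  continuousOn ℓ hℓ := by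
    refine (hΦ.continuousOn ℓ hℓ).comp
      (f := fun z : H × (Fin ℓ → H) => (T z.1, L ∘ z.2)) (Continuous.continuousOn ?_)
      fun z hz => ⟨hCU hz.1, mem_univ _⟩
    refine (hT.comp continuous_fst).prodMk (continuous_pi fun i => ?_)
    exact L.continuous.comp ((continuous_apply i).comp continuous_snd)
  hasDirDeriv ℓ hℓ x hx v w := by
    rw [Fin.comp_snoc]
    exact (hΦ.hasDirDeriv ℓ hℓ (T x) (hU hx) (L ∘ v) (L w)).comp_affine (hTL x w)

variable [ContinuousAdd H] [ContinuousSMul ℝ H]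

/-- Being a jet is a local property. -/
theorem IsJet.of_local (hUCU : U ⊆ CU)
    (h : ∀ z ∈ CU, ∃ O : Set H, IsOpen O ∧ z ∈ O ∧ ∃ Ψ : (ℓ : ℕ) → H → (Fin ℓ → H) → F,
      IsJet k (U ∩ O) (CU ∩ O) Ψ ∧
        ∀ ℓ : ℕ, (ℓ : ℕ∞) ≤ k → ∀ x ∈ CU ∩ O, ∀ v : Fin ℓ → H, Φ ℓ x v = Ψ ℓ x v)
    (hU : IsOpen U) : IsJet k U CU Φ where
  continuousOn ℓ hℓ := by
    rintro ⟨z, v⟩ ⟨hz, -⟩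
    obtain ⟨O, hO, hzO, Ψ, hΨ, heq⟩ := h z hz
    have h1 : ContinuousOn (fun z : H × (Fin ℓ → H) => Φ ℓ z.1 z.2) ((CU ∩ O) ×ˢ univ) :=
      (hΨ.continuousOn ℓ hℓ).congr fun p hp => heq ℓ hℓ p.1 hp.1 p.2
    refine (h1 (z, v) ⟨⟨hz, hzO⟩, mem_univ _⟩).mono_of_mem_nhdsWithin ?_
    filter_upwards [self_mem_nhdsWithin, mem_nhdsWithin_of_mem_nhds
      ((hO.preimage continuous_fst).mem_nhds (x := ((z, v) : H × (Fin ℓ → H))) hzO)] with p hp hpO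
    exact ⟨⟨hp.1, hpO⟩, mem_univ _⟩
  hasDirDeriv ℓ hℓ x hx v w := by
    obtain ⟨O, hO, hxO, Ψ, hΨ, heq⟩ := h x (hUCU hx)
    rw [heq (ℓ + 1) (natCast_succ_le_of_lt hℓ) x ⟨hUCU hx, hxO⟩]
    exact (hΨ.hasDirDeriv ℓ hℓ x ⟨hx, hxO⟩ v w).congr (hU.inter hO) ⟨hx, hxO⟩
      fun z hz => (heq ℓ hℓ.le z ⟨hUCU hz.1, hz.2⟩ v).symm

variable [T2Space F]

omit [AddCommGroup H] [Module ℝ H] [AddCommGroup F] [Module ℝ F] [ContinuousAdd H]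
    [ContinuousSMul ℝ H] in
/-- An identity between continuous maps on `CU × P` that holds on `U × P` holds everywhere if `CU`
is contained in the closure of `U`; here localized to an open set `O`. -/
theorem eq_of_eqOn_inter {P : Type*} [TopologicalSpace P] {O : Set H}
    (hUCU : U ⊆ CU) (hCU : CU ⊆ closure U) (hO : IsOpen O) {f g : H × P → F}
    (hf : ContinuousOn f (CU ×ˢ univ)) (hg : ContinuousOn g (CU ×ˢ univ))
    (h : ∀ x ∈ U ∩ O, ∀ p, f (x, p) = g (x, p)) {x : H} (hx : x ∈ CU ∩ O) (p : P) :
    f (x, p) = g (x, p) := by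
  have key : EqOn (fun x => f (x, p)) (fun x => g (x, p)) (CU ∩ O) := by
    refine EqOn.of_subset_closure (s := U ∩ O) (fun x hx => h x hx p) ?_ ?_
      (inter_subset_inter_left _ hUCU) ?_
    · exact hf.comp (f := fun x => (x, p)) (by fun_prop) fun z hz => ⟨hz.1, mem_univ _⟩
    · exact hg.comp (f := fun x => (x, p)) (by fun_prop) fun z hz => ⟨hz.1, mem_univ _⟩
    · rintro z ⟨hz, hzO⟩
      rw [inter_comm]
      exact hO.inter_closure ⟨hzO, hCU hz⟩
  exact key hx

/-- A jet is determined, even locally, by its component of order `0`. -/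
theorem IsJet.eq_of_eq_zero (hΦ : IsJet k U CU Φ) (hΨ : IsJet k U CU Ψ) (hU : IsOpen U)
    (hUCU : U ⊆ CU) (hCU : CU ⊆ closure U) {O : Set H} (hO : IsOpen O)
    (h : ∀ x ∈ U ∩ O, ∀ v, Φ 0 x v = Ψ 0 x v) {ℓ : ℕ} (hℓ : (ℓ : ℕ∞) ≤ k) {x : H}
    (hx : x ∈ CU ∩ O) (v : Fin ℓ → H) : Φ ℓ x v = Ψ ℓ x v := by
  have key : ∀ ℓ : ℕ, (ℓ : ℕ∞) ≤ k → ∀ x ∈ U ∩ O, ∀ v, Φ ℓ x v = Ψ ℓ x v := by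
    intro ℓ
    induction ℓ with
    | zero => exact fun _ => h
    | succ ℓ ih =>
      intro hℓ x hx v
      have hℓ' := natCast_lt_of_succ_le hℓ
      have h1 := hΦ.hasDirDeriv ℓ hℓ' x hx.1 (Fin.init v) (v (Fin.last ℓ))
      have h2 := hΨ.hasDirDeriv ℓ hℓ' x hx.1 (Fin.init v) (v (Fin.last ℓ))
      rw [Fin.snoc_init_self] at h1 h2
      exact (h1.congr (hU.inter hO) hx fun z hz => ih hℓ'.le z hz _).unique h2
  exact eq_of_eqOn_inter hUCU hCU hO (hΦ.continuousOn ℓ hℓ) (hΨ.continuousOn ℓ hℓ)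
    (key ℓ hℓ) hx v

/-! ### Jets and the mapping spaces -/

theorem IsJet.differential_eq (hΦ : IsJet k U CU Φ) (hU : IsOpen U) {f : H → F}
    (hf : ∀ x ∈ U, ∀ v, f x = Φ 0 x v) : ∀ ℓ : ℕ, (ℓ : ℕ∞) ≤ k → ∀ x ∈ U, ∀ v : Fin ℓ → H,
      differential f ℓ x v = Φ ℓ x v
  | 0, _, x, hx, v => hf x hx v
  | ℓ + 1, hℓ, x, hx, v => by
    have hℓ' := natCast_lt_of_succ_le hℓ
    have h1 := hΦ.hasDirDeriv ℓ hℓ' x hx (Fin.init v) (v (Fin.last ℓ))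
    rw [Fin.snoc_init_self] at h1
    exact (h1.congr hU hx fun z hz =>
      (hΦ.differential_eq hU hf ℓ hℓ'.le z hz (Fin.init v)).symm).dirDeriv_eq

variable [IsTopologicalAddGroup F] [ContinuousSMul ℝ F]

omit [AddCommGroup H] [Module ℝ H] [Module ℝ F] [TopologicalSpace F] [ContinuousAdd H]
    [ContinuousSMul ℝ H] [T2Space F] [IsTopologicalAddGroup F] [ContinuousSMul ℝ F] in
theorem DomainPair.lift_apply (A : DomainPair H) (f : A.U → F) {x : H} (hx : x ∈ A.U) :
    A.lift f x = f ⟨x, hx⟩ :=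
  Subtype.val_injective.extend_apply f 0 ⟨x, hx⟩

theorem CkExt.isJet {A : DomainPair H} (f : CkExt F k A) : IsJet k A.U A.CU (CkExt.ext f) where
  continuousOn ℓ hℓ := (CkExt.ext_spec f hℓ).continuousOn
  hasDirDeriv ℓ hℓ x hx v w := by
    rw [(CkExt.ext_spec f (natCast_succ_le_of_lt hℓ)).eq x hx]
    have h := f.2.1.hasDirDeriv hℓ hx v w
    have h2 : differential (A.lift (f : A.U → F)) (ℓ + 1) x (Fin.snoc (α := fun _ => H) v w) =
        dirDeriv (fun z => differential (A.lift (f : A.U → F)) ℓ z v) x w := by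
      simp only [differential, Fin.init_snoc, Fin.snoc_last]
    rw [h2]
    exact h.congr A.isOpen hx fun z hz => ((CkExt.ext_spec f hℓ.le).eq z hz v).symm

theorem CkExt.ext_zero_apply {A : DomainPair H} (f : CkExt F k A) {x : H} (hx : x ∈ A.U)
    (v : Fin 0 → H) : CkExt.ext f 0 x v = (f : A.U → F) ⟨x, hx⟩ :=
  ((CkExt.ext_spec f (by simp)).eq x hx v).trans (A.lift_apply _ hx)

theorem IsJet.mem_ckExt {A : DomainPair H} (hΦ : IsJet k A.U A.CU Φ) {f : A.U → F}
    (hf : ∀ x : A.U, ∀ v, f x = Φ 0 x v) : f ∈ CkExt F k A := by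
  have hd := hΦ.differential_eq A.isOpen (f := A.lift f)
    (fun x hx v => (A.lift_apply f hx).trans (hf ⟨x, hx⟩ v))
  refine ⟨⟨fun p hp v x hx w => ⟨_, (hΦ.hasDirDeriv p hp x hx v w).congr A.isOpen hx
    fun z hz => (hd p hp.le z hz v).symm⟩, fun p hp => ?_⟩, fun ℓ hℓ => ⟨Φ ℓ, ?_, ?_⟩⟩
  · exact ((hΦ.continuousOn p hp).mono (prod_mono A.subset subset_rfl)).congr
      fun z hz => hd p hp z.1 hz.1 z.2
  · exact hΦ.continuousOn ℓ hℓ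
  · exact fun x hx v => (hd ℓ hℓ x hx v).symm

/-! ### Multilinearity of the differentials -/

variable [LocallyConvexSpace ℝ F]

theorem IsJet.map_update_add_of_mem (hΦ : IsJet k U CU Φ) (hU : IsOpen U) (hUCU : U ⊆ CU) :
    ∀ ℓ : ℕ, (ℓ : ℕ∞) ≤ k → ∀ x ∈ U, ∀ (v : Fin ℓ → H) (i : Fin ℓ) (a b : H),
      Φ ℓ x (Function.update v i (a + b)) =
        Φ ℓ x (Function.update v i a) + Φ ℓ x (Function.update v i b)
  | 0, _, _, _, _, i, _, _ => i.elim0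
  | ℓ + 1, hℓ, x, hx, v, i, a, b => by
    have hℓ' := natCast_lt_of_succ_le hℓ
    obtain ⟨v, w, rfl⟩ : ∃ (v' : Fin ℓ → H) (w : H), v = Fin.snoc (α := fun _ => H) v' w :=
      ⟨Fin.init v, v (Fin.last ℓ), (Fin.snoc_init_self v).symm⟩
    induction i using Fin.lastCases with
    | last =>
      simp only [Fin.update_snoc_last]
      have hc : ContinuousAt (fun z => Φ (ℓ + 1) z (Fin.snoc (α := fun _ => H) v b)) x :=
        ((hΦ.continuousOn_apply hℓ _).mono hUCU).continuousAt (hU.mem_nhds hx)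
      refine (hΦ.hasDirDeriv ℓ hℓ' x hx v (a + b)).unique
        ((hΦ.hasDirDeriv ℓ hℓ' x hx v a).add_dir ?_ hc)
      filter_upwards [hU.mem_nhds hx] with z hz
      exact hΦ.hasDirDeriv ℓ hℓ' z hz v b
    | cast i =>
      simp only [← Fin.snoc_update (α := fun _ => H)]
      refine (hΦ.hasDirDeriv ℓ hℓ' x hx (Function.update v i (a + b)) w).unique
        (((hΦ.hasDirDeriv ℓ hℓ' x hx (Function.update v i a) w).add
          (hΦ.hasDirDeriv ℓ hℓ' x hx (Function.update v i b) w)).congr hU hx fun z hz => ?_)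
      exact (hΦ.map_update_add_of_mem hU hUCU ℓ hℓ'.le z hz v i a b).symm

omit [IsTopologicalAddGroup F] [LocallyConvexSpace ℝ F] in
theorem IsJet.map_update_smul_of_mem (hΦ : IsJet k U CU Φ) (hU : IsOpen U) :
    ∀ ℓ : ℕ, (ℓ : ℕ∞) ≤ k → ∀ x ∈ U, ∀ (v : Fin ℓ → H) (i : Fin ℓ) (c : ℝ) (a : H),
      Φ ℓ x (Function.update v i (c • a)) = c • Φ ℓ x (Function.update v i a)
  | 0, _, _, _, _, i, _, _ => i.elim0
  | ℓ + 1, hℓ, x, hx, v, i, c, a => by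
    have hℓ' := natCast_lt_of_succ_le hℓ
    obtain ⟨v, w, rfl⟩ : ∃ (v' : Fin ℓ → H) (w : H), v = Fin.snoc (α := fun _ => H) v' w :=
      ⟨Fin.init v, v (Fin.last ℓ), (Fin.snoc_init_self v).symm⟩
    induction i using Fin.lastCases with
    | last =>
      simp only [Fin.update_snoc_last]
      exact (hΦ.hasDirDeriv ℓ hℓ' x hx v (c • a)).unique
        ((hΦ.hasDirDeriv ℓ hℓ' x hx v a).smul_dir c)
    | cast i =>
      simp only [← Fin.snoc_update (α := fun _ => H)]
      refine (hΦ.hasDirDeriv ℓ hℓ' x hx (Function.update v i (c • a)) w).unique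
        (((hΦ.hasDirDeriv ℓ hℓ' x hx (Function.update v i a) w).const_smul c).congr hU hx
          fun z hz => ?_)
      exact (hΦ.map_update_smul_of_mem hU ℓ hℓ'.le z hz v i c a).symm

/-- The components of a jet are multilinear, on all of `CU` by density. -/
theorem IsJet.exists_multilinearMap (hΦ : IsJet k U CU Φ) (hU : IsOpen U) (hUCU : U ⊆ CU)
    (hCU : CU ⊆ closure U) {ℓ : ℕ} (hℓ : (ℓ : ℕ∞) ≤ k) {x : H} (hx : x ∈ CU) :
    ∃ M : MultilinearMap ℝ (fun _ : Fin ℓ => H) F, ∀ v, M v = Φ ℓ x v := by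
  have hc : ∀ v : Fin ℓ → H, ContinuousOn (fun z : H × Unit => Φ ℓ z.1 v) (CU ×ˢ univ) :=
    fun v => (hΦ.continuousOn_apply hℓ v).comp continuousOn_fst fun z hz => hz.1
  refine ⟨MultilinearMap.mk' (fun v => Φ ℓ x v) (fun v i a b => ?_) (fun v i c a => ?_),
    fun v => rfl⟩
  · exact eq_of_eqOn_inter hUCU hCU isOpen_univ (hc _) ((hc _).add (hc _))
      (fun z hz _ => hΦ.map_update_add_of_mem hU hUCU ℓ hℓ z hz.1 v i a b)
      ⟨hx, mem_univ _⟩ ()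
  · exact eq_of_eqOn_inter hUCU hCU isOpen_univ (hc _) ((hc _).const_smul c)
      (fun z hz _ => hΦ.map_update_smul_of_mem hU ℓ hℓ z hz.1 v i c a)
      ⟨hx, mem_univ _⟩ ()

end Jet

/-! ### Products with a function of a linear functional -/

section Leibniz

variable {H F : Type*} [AddCommGroup H] [Module ℝ H] [TopologicalSpace H]
  [AddCommGroup F] [Module ℝ F] [TopologicalSpace F]

/-- The Leibniz expression for the `ℓ`-th differential, along `v`, of the product of
`χ^(r) ∘ lam` and `Φ m (·, u)`. The recursion peels off the first of the vectors `v`, which either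
hits the scalar factor or joins the vectors `u`. -/
def leibniz (lam : H →L[ℝ] ℝ) (χ : ℝ → ℝ) (Φ : (ℓ : ℕ) → H → (Fin ℓ → H) → F) :
    (ℓ r m : ℕ) → (Fin m → H) → H → (Fin ℓ → H) → F
  | 0, r, m, u, z, _ => iteratedDeriv r χ (lam z) • Φ m z u
  | ℓ + 1, r, m, u, z, v => lam (v 0) • leibniz lam χ Φ ℓ (r + 1) m u z (Fin.tail v) +
      leibniz lam χ Φ ℓ r (m + 1) (Fin.snoc (α := fun _ => H) u (v 0)) z (Fin.tail v)

variable [ContinuousAdd H] [ContinuousSMul ℝ H] [IsTopologicalAddGroup F] [ContinuousSMul ℝ F]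
  {k : ℕ∞} {U CU : Set H} {Φ : (ℓ : ℕ) → H → (Fin ℓ → H) → F}

omit [ContinuousAdd H] [ContinuousSMul ℝ H] in
theorem IsJet.continuousOn_leibniz (hΦ : IsJet k U CU Φ) (lam : H →L[ℝ] ℝ) {χ : ℝ → ℝ}
    (hχ : ContDiff ℝ ∞ χ) : ∀ ℓ r m : ℕ, ((m + ℓ : ℕ) : ℕ∞) ≤ k →
      ContinuousOn (fun p : H × (Fin m → H) × (Fin ℓ → H) =>
        leibniz lam χ Φ ℓ r m p.2.1 p.1 p.2.2) (CU ×ˢ univ)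
  | 0, r, m, hm => by
    have h1 : Continuous fun p : H × (Fin m → H) × (Fin 0 → H) =>
        iteratedDeriv r χ (lam p.1) :=
      (hχ.continuous_iteratedDeriv r (by exact_mod_cast le_top)).comp (by fun_prop)
    have h2 : ContinuousOn (fun p : H × (Fin m → H) × (Fin 0 → H) => Φ m p.1 p.2.1)
        (CU ×ˢ univ) := (hΦ.continuousOn m hm).comp
      (f := fun p : H × (Fin m → H) × (Fin 0 → H) => (p.1, p.2.1)) (by fun_prop)
      fun p hp => ⟨hp.1, mem_univ _⟩
    exact h1.continuousOn.smul h2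
  | ℓ + 1, r, m, hm => by
    have h1 := (hΦ.continuousOn_leibniz lam hχ ℓ (r + 1) m
      (le_trans (by exact_mod_cast (by omega : m + ℓ ≤ m + (ℓ + 1))) hm)).comp
      (f := fun p : H × (Fin m → H) × (Fin (ℓ + 1) → H) => (p.1, p.2.1, Fin.tail p.2.2))
      (s := CU ×ˢ univ) (Continuous.continuousOn (by unfold Fin.tail; fun_prop))
      fun p hp => ⟨hp.1, mem_univ _⟩
    have h2 := (hΦ.continuousOn_leibniz lam hχ ℓ r (m + 1)
      (by rwa [show m + 1 + ℓ = m + (ℓ + 1) by omega])).comp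
      (f := fun p : H × (Fin m → H) × (Fin (ℓ + 1) → H) =>
        (p.1, Fin.snoc (α := fun _ => H) p.2.1 (p.2.2 0), Fin.tail p.2.2))
      (s := CU ×ˢ univ) (Continuous.continuousOn (by unfold Fin.tail; fun_prop))
      fun p hp => ⟨hp.1, mem_univ _⟩
    have h3 : Continuous fun p : H × (Fin m → H) × (Fin (ℓ + 1) → H) => lam (p.2.2 0) := by
      fun_prop
    exact (h3.continuousOn.smul h1).add h2

theorem IsJet.hasDirDeriv_leibniz (hΦ : IsJet k U CU Φ) (hU : IsOpen U) (hUCU : U ⊆ CU)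
    (lam : H →L[ℝ] ℝ) {χ : ℝ → ℝ} (hχ : ContDiff ℝ ∞ χ) {x : H} (hx : x ∈ U) (w : H) :
    ∀ (ℓ r m : ℕ), ((m + ℓ : ℕ) : ℕ∞) < k → ∀ (u : Fin m → H) (v : Fin ℓ → H),
      HasDirDeriv (fun z => leibniz lam χ Φ ℓ r m u z v) x w
        (leibniz lam χ Φ (ℓ + 1) r m u x (Fin.snoc (α := fun _ => H) v w))
  | 0, r, m, hm, u, v => by
    have h1 : HasDerivAt (iteratedDeriv r χ) (iteratedDeriv (r + 1) χ (lam x)) (lam x) := by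
      rw [iteratedDeriv_succ]
      exact ((hχ.differentiable_iteratedDeriv r
        (by exact_mod_cast ENat.natCast_lt_top r)) _).hasDerivAt
    have h2 := (((hΦ.continuousOn_apply (ℓ := m) hm.le u).mono hUCU).continuousAt
      (hU.mem_nhds hx)).tendsto.comp (tendsto_add_smul_nhdsNE x w)
    have h3 := HasDirDeriv.smul_comp_clm lam h1 (hΦ.hasDirDeriv m hm x hx u w) h2
    simpa [leibniz, smul_smul, Fin.snoc] using h3
  | ℓ + 1, r, m, hm, u, v => by
    have h1 := hΦ.hasDirDeriv_leibniz hU hUCU lam hχ hx w ℓ (r + 1) m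
      (lt_of_le_of_lt (by exact_mod_cast (by omega : m + ℓ ≤ m + (ℓ + 1))) hm) u (Fin.tail v)
    have h2 := hΦ.hasDirDeriv_leibniz hU hUCU lam hχ hx w ℓ r (m + 1)
      (by rwa [show m + 1 + ℓ = m + (ℓ + 1) by omega])
      (Fin.snoc (α := fun _ => H) u (v 0)) (Fin.tail v)
    have h3 := (h1.const_smul (lam (v 0))).add h2
    obtain ⟨a, v, rfl⟩ : ∃ (a : H) (v' : Fin ℓ → H), v = Fin.cons (α := fun _ => H) a v' :=
      ⟨v 0, Fin.tail v, (Fin.cons_self_tail v).symm⟩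
    rw [← Fin.cons_snoc_eq_snoc_cons]
    simpa only [leibniz.eq_2, Fin.tail_cons, Fin.cons_zero] using h3

/-- The product of `χ ∘ lam` with a map of class `C^k` has a jet, with the expected component of
order `0`. -/
theorem IsJet.leibniz (hΦ : IsJet k U CU Φ) (hU : IsOpen U) (hUCU : U ⊆ CU)
    (lam : H →L[ℝ] ℝ) {χ : ℝ → ℝ} (hχ : ContDiff ℝ ∞ χ) :
    IsJet k U CU (fun ℓ z v => leibniz lam χ Φ ℓ 0 0 ![] z v) where
  continuousOn ℓ hℓ := (hΦ.continuousOn_leibniz lam hχ ℓ 0 0 (by simpa using hℓ)).comp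
    (f := fun p : H × (Fin ℓ → H) => (p.1, (![] : Fin 0 → H), p.2)) (by fun_prop)
    fun p hp => ⟨hp.1, mem_univ _⟩
  hasDirDeriv ℓ hℓ x hx v w :=
    hΦ.hasDirDeriv_leibniz hU hUCU lam hχ hx w ℓ 0 0 (by simpa using hℓ) _ v

end Leibniz

/-! ### The coefficients of the reflection formula -/

section Coefficients

/-- The value at `-1` of the `j`-th Lagrange basis polynomial for the nodes `2 ^ i`, `i < N`; zero
if `N ≤ j`. -/
def lagrangeCoeff (N j : ℕ) : ℝ :=
  if j < N then (Lagrange.basis (Finset.range N) (fun i : ℕ => (2 : ℝ) ^ i) j).eval (-1) else 0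

theorem sum_lagrangeCoeff {N m : ℕ} (h : m < N) :
    ∑ j ∈ Finset.range N, lagrangeCoeff N j * (2 ^ j) ^ m = (-1) ^ m := by
  have hinj : Set.InjOn (fun i : ℕ => (2 : ℝ) ^ i) (Finset.range N) :=
    (pow_right_injective₀ (by norm_num) (by norm_num)).injOn
  have h1 := Lagrange.eq_interpolate (f := (Polynomial.X ^ m : Polynomial ℝ)) hinj (by
    rw [Polynomial.degree_X_pow, Finset.card_range]
    exact_mod_cast h)
  have h2 := congrArg (Polynomial.eval (-1)) h1
  rw [Lagrange.interpolate_apply, Polynomial.eval_finsetSum] at h2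
  simp only [Polynomial.eval_pow, Polynomial.eval_X, Polynomial.eval_mul,
    Polynomial.eval_C] at h2
  rw [h2]
  refine Finset.sum_congr rfl fun j hj => ?_
  rw [lagrangeCoeff, if_pos (Finset.mem_range.1 hj), mul_comm]

/-- A bound for the coefficients `lagrangeCoeff N j` that does not depend on `N`. -/
def coeffBound (j : ℕ) : ℝ :=
  (∏ i ∈ Finset.range j, 4 * (2 : ℝ) ^ i / 2 ^ j) * Real.exp 4

theorem coeffBound_pos (j : ℕ) : 0 < coeffBound j := by
  unfold coeffBound; positivity

theorem coeffBound_succ (j : ℕ) : coeffBound (j + 1) = 2 / 2 ^ j * coeffBound j := by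
  have h : ∀ i, 4 * (2 : ℝ) ^ i / 2 ^ (j + 1) = 4 * (2 : ℝ) ^ i / 2 ^ j * 2⁻¹ := fun i => by
    rw [pow_succ]; field_simp
  rw [coeffBound, coeffBound, Finset.prod_range_succ, Finset.prod_congr rfl fun i _ => h i,
    Finset.prod_mul_distrib, Finset.prod_const, Finset.card_range, inv_pow, pow_succ]
  field_simp
  norm_num

theorem summable_coeffBound (m : ℕ) : Summable fun j => coeffBound j * (2 ^ j) ^ m := by
  refine summable_of_ratio_test_tendsto_lt_one zero_lt_one
    (Eventually.of_forall fun j => (mul_pos (coeffBound_pos j) (by positivity)).ne') ?_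
  have h : Tendsto (fun j : ℕ => 2 * 2 ^ m * (2⁻¹ : ℝ) ^ j) atTop (𝓝 (2 * 2 ^ m * 0)) :=
    (tendsto_pow_atTop_nhds_zero_of_lt_one (by norm_num) (by norm_num)).const_mul _
  rw [mul_zero] at h
  refine h.congr fun j => ?_
  have hp := coeffBound_pos j
  rw [Real.norm_of_nonneg (mul_pos (coeffBound_pos _) (by positivity)).le,
    Real.norm_of_nonneg (mul_pos hp (by positivity)).le, coeffBound_succ, pow_succ 2 j, mul_pow,
    inv_pow]
  field_simp

/-- The nodes below `2 ^ j` contribute rapidly decreasing factors to `lagrangeCoeff N j`, those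
above `2 ^ j` contribute factors with bounded product. -/
theorem abs_lagrangeCoeff_le (N j : ℕ) : |lagrangeCoeff N j| ≤ coeffBound j := by
  rw [lagrangeCoeff]
  split_ifs with hjN
  swap
  · simpa using (coeffBound_pos j).le
  obtain ⟨d, rfl⟩ : ∃ d, N = j + 1 + d := ⟨N - (j + 1), by omega⟩
  set g : ℕ → ℝ := fun i => |((2 : ℝ) ^ j - 2 ^ i)⁻¹ * (-1 - 2 ^ i)| with hg
  have heval : |(Lagrange.basis (Finset.range (j + 1 + d)) (fun i : ℕ => (2 : ℝ) ^ i) j).eval (-1)|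
      = (∏ i ∈ Finset.range j, g i) * ∏ s ∈ Finset.range d, g (j + 1 + s) := by
    rw [Lagrange.basis, Polynomial.eval_prod, Finset.abs_prod]
    have h1 : ∏ i ∈ (Finset.range (j + 1 + d)).erase j,
        |(Lagrange.basisDivisor ((2 : ℝ) ^ j) (2 ^ i)).eval (-1)| =
        ∏ i ∈ Finset.range (j + 1 + d), if i = j then 1 else g i := by
      rw [← Finset.prod_erase_mul _ _ (Finset.mem_range.2 hjN), if_pos rfl, mul_one]
      refine Finset.prod_congr rfl fun i hi => ?_
      rw [if_neg (Finset.ne_of_mem_erase hi)]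
      simp [Lagrange.basisDivisor, hg]
    rw [h1, Finset.prod_range_add, Finset.prod_range_succ, if_pos rfl, mul_one]
    congr 1
    · exact Finset.prod_congr rfl fun i hi => if_neg (Finset.mem_range.1 hi).ne
    · exact Finset.prod_congr rfl fun i _ => if_neg (by omega)
  have hnum : ∀ i : ℕ, |(-1 - 2 ^ i : ℝ)| = 1 + 2 ^ i := fun i => by
    have : (0 : ℝ) < 2 ^ i := by positivity
    rw [abs_of_neg (by linarith)]; ring
  rw [heval, coeffBound]
  refine mul_le_mul (Finset.prod_le_prod (fun _ _ => abs_nonneg _) fun i hi => ?_) ?_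
    (Finset.prod_nonneg fun _ _ => abs_nonneg _) (by positivity)
  · have hi1 : (1 : ℝ) ≤ 2 ^ i := one_le_pow₀ (by norm_num)
    have h2 : (2 : ℝ) ^ i * 2 ≤ 2 ^ j := by
      rw [← pow_succ]
      exact pow_le_pow_right₀ (by norm_num) (Finset.mem_range.1 hi)
    rw [hg]
    dsimp only
    rw [abs_mul, abs_inv, hnum, inv_mul_eq_div, abs_of_pos (by linarith),
      div_le_div_iff₀ (by linarith) (by linarith)]
    nlinarith
  · have hfac : ∀ s ∈ Finset.range d, g (j + 1 + s) ≤ Real.exp (2 * (1 / 2) ^ s) := by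
      intro s _
      have hj1 : (1 : ℝ) ≤ 2 ^ j := one_le_pow₀ (by norm_num)
      have hs1 : (1 : ℝ) ≤ 2 ^ s := one_le_pow₀ (by norm_num)
      have h2 : (2 : ℝ) ^ (j + 1 + s) = 2 * (2 ^ j * 2 ^ s) := by ring
      have h3 : (2 : ℝ) ^ j ≤ 2 ^ j * 2 ^ s := le_mul_of_one_le_right (by linarith) hs1
      refine le_trans ?_ (Real.add_one_le_exp _)
      rw [hg]
      dsimp only
      rw [abs_mul, abs_inv, hnum, inv_mul_eq_div, abs_sub_comm, h2, abs_of_pos (by linarith),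
        div_le_iff₀ (by linarith), one_div, inv_pow]
      have h4 : (2 * ((2 : ℝ) ^ s)⁻¹ + 1) * (2 * (2 ^ j * 2 ^ s) - 2 ^ j) =
          4 * 2 ^ j - 2 * 2 ^ j * (2 ^ s)⁻¹ + 2 * (2 ^ j * 2 ^ s) - 2 ^ j := by
        field_simp
        ring
      have h5 : (2 : ℝ) ^ j * (2 ^ s)⁻¹ ≤ 2 ^ j :=
        mul_le_of_le_one_right (by linarith) (inv_le_one_of_one_le₀ hs1)
      rw [h4]
      linarith
    refine (Finset.prod_le_prod (fun _ _ => abs_nonneg _) hfac).trans ?_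
    rw [← Real.exp_sum, Real.exp_le_exp, ← Finset.mul_sum]
    linarith [sum_geometric_two_le d]

/-- There are rapidly decreasing coefficients with `∑ c_j (2 ^ j) ^ m = (-1) ^ m` for all `m`. They
are limits, along an ultrafilter, of the coefficients that evaluate polynomials of bounded degree at
`-1`. -/
theorem exists_reflection_coeff : ∃ c : ℕ → ℝ, ∀ m : ℕ,
    (Summable fun j => |c j| * (2 ^ j) ^ m) ∧ HasSum (fun j => c j * (2 ^ j) ^ m) ((-1) ^ m) := by
  obtain ⟨c, hc, hlim⟩ := (isCompact_univ_pi fun j : ℕ =>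
    isCompact_Icc (a := -coeffBound j) (b := coeffBound j)).ultrafilter_le_nhds
      ((hyperfilter ℕ).map lagrangeCoeff) (le_principal_iff.2 (Ultrafilter.mem_map.2
        (univ_mem' fun n j _ => abs_le.1 (abs_lagrangeCoeff_le n j))))
  have hlim' : ∀ j, Tendsto (fun n => lagrangeCoeff n j) (hyperfilter ℕ) (𝓝 (c j)) := fun j =>
    ((continuous_apply j).tendsto c).comp
      (show Tendsto lagrangeCoeff (hyperfilter ℕ) (𝓝 c) from hlim)
  refine ⟨c, fun m => ?_⟩
  have hs : Summable fun j => |c j| * (2 ^ j) ^ m :=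
    (summable_coeffBound m).of_nonneg_of_le (fun j => by positivity)
      fun j => mul_le_mul_of_nonneg_right (abs_le.2 (hc j (mem_univ j))) (by positivity)
  refine ⟨hs, ?_⟩
  have hs' : Summable fun j => c j * (2 ^ j) ^ m :=
    Summable.of_norm (hs.congr fun j => by simp)
  have key := tendsto_tsum_of_dominated_convergence (𝓕 := (hyperfilter ℕ : Filter ℕ))
    (f := fun n j => lagrangeCoeff n j * (2 ^ j) ^ m)
    (g := fun j => c j * (2 ^ j) ^ m) (summable_coeffBound m)
    (fun j => (hlim' j).mul_const _) (Eventually.of_forall fun n j => by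
      rw [norm_mul, Real.norm_eq_abs, Real.norm_of_nonneg (by positivity)]
      exact mul_le_mul_of_nonneg_right (abs_lagrangeCoeff_le n j) (by positivity))
  have hval : ∀ᶠ n in (hyperfilter ℕ : Filter ℕ),
      (-1) ^ m = ∑' j, lagrangeCoeff n j * (2 ^ j) ^ m := by
    filter_upwards [Nat.hyperfilter_le_atTop (eventually_gt_atTop m)] with n hn
    rw [← sum_lagrangeCoeff hn, tsum_eq_sum (s := Finset.range n)]
    intro j hj
    rw [lagrangeCoeff, if_neg (by simpa using hj), zero_mul]
  rw [tendsto_nhds_unique (tendsto_const_nhds.congr' hval) key]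
  exact hs'.hasSum

end Coefficients

/-! ### Sums in a locally convex space -/

section Sums

variable {F : Type*} [AddCommGroup F] [Module ℝ F]

theorem map_smul_add_eq_sum {H : Type*} [AddCommGroup H] [Module ℝ H] {ℓ : ℕ}
    (M : MultilinearMap ℝ (fun _ : Fin ℓ => H) F) (m₁ m₀ : Fin ℓ → H) (α : ℝ) :
    M (fun i => α • m₁ i + m₀ i) =
      ∑ s : Finset (Fin ℓ), α ^ s.card • M (s.piecewise m₁ m₀) := by
  have h := M.map_add_univ (fun i => α • m₁ i) m₀
  refine h.trans (Finset.sum_congr rfl fun s _ => ?_)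
  have h2 := M.map_piecewise_smul (fun _ => α) (s.piecewise m₁ m₀) s
  rw [Finset.prod_const] at h2
  rw [← h2]
  congr 1
  ext i
  by_cases hi : i ∈ s <;> simp [hi]

/-- Since a multilinear map is polynomial along lines, coefficients which evaluate polynomials at
`-1` from their values at the nodes `2 ^ j` do so for multilinear maps as well. -/
theorem hasSum_smul_multilinear [TopologicalSpace F] [IsTopologicalAddGroup F] [ContinuousSMul ℝ F]
    {H : Type*} [AddCommGroup H] [Module ℝ H] {c : ℕ → ℝ}
    (hc : ∀ m : ℕ, HasSum (fun j => c j * (2 ^ j) ^ m) ((-1) ^ m)) {ℓ : ℕ}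
    (M : MultilinearMap ℝ (fun _ : Fin ℓ => H) F) (m₁ m₀ : Fin ℓ → H) :
    HasSum (fun j => c j • M (fun i => (2 : ℝ) ^ j • m₁ i + m₀ i))
      (M (fun i => (-1 : ℝ) • m₁ i + m₀ i)) := by
  simp only [map_smul_add_eq_sum, Finset.smul_sum, smul_smul]
  exact hasSum_sum fun s _ => (hc s.card).smul_const _

variable [TopologicalSpace F] [IsTopologicalAddGroup F] [ContinuousSMul ℝ F]
  [LocallyConvexSpace ℝ F]

/-- Dominated convergence for series in a locally convex space. No completeness is needed, since
the sums `∑' j, t i j` are finite and the limit series is assumed to converge. -/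
theorem tendsto_tsum_of_seminorm_le {ι : Type*} {l : Filter ι} {t : ι → ℕ → F} {s : ℕ → F}
    {S : F} (hfin : ∀ᶠ i in l, (Function.support (t i)).Finite) (hs : HasSum s S)
    (ht : ∀ j, Tendsto (fun i => t i j) l (𝓝 (s j)))
    (hb : ∀ q : Seminorm ℝ F, Continuous q → ∃ B : ℕ → ℝ, (∀ j, 0 ≤ B j) ∧ Summable B ∧
      ∀ᶠ i in l, ∀ j, q (t i j) ≤ B j) :
    Tendsto (fun i => ∑' j, t i j) l (𝓝 S) := by
  refine tendsto_of_seminorm fun q hq ε hε => ?_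
  obtain ⟨B, hB0, hBs, hB⟩ := hb q hq
  have hε' : 0 < ε / 3 := by positivity
  have hsmall : ∀ {κ : Type} {l' : Filter κ} {u : κ → F} {y : F}, Tendsto u l' (𝓝 y) →
      ∀ᶠ i in l', q (u i - y) < ε / 3 := by
    intro κ l' u y hu
    have h1 : Tendsto (fun i => q (u i - y)) l' (𝓝 (q (y - y))) :=
      (hq.tendsto _).comp (hu.sub_const y)
    rw [sub_self, map_zero] at h1
    exact h1.eventually (gt_mem_nhds hε')
  have h1 : ∀ᶠ u : Finset ℕ in atTop, q (∑ j ∈ u, s j - S) < ε / 3 := hsmall hs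
  have h2 : ∀ᶠ u : Finset ℕ in atTop, ∑' j, B j - ε / 3 < ∑ j ∈ u, B j :=
    hBs.hasSum.eventually (lt_mem_nhds (by linarith))
  obtain ⟨u, hu1, hu2⟩ := (h1.and h2).exists
  have h3 : ∀ᶠ i in l, q (∑ j ∈ u, t i j - ∑ j ∈ u, s j) < ε / 3 := by
    have h4 : Tendsto (fun i => q (∑ j ∈ u, t i j - ∑ j ∈ u, s j)) l
        (𝓝 (q (∑ j ∈ u, s j - ∑ j ∈ u, s j))) :=
      (hq.tendsto _).comp ((tendsto_finsetSum u fun j _ => ht j).sub_const _)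
    rw [sub_self, map_zero] at h4
    exact h4.eventually (gt_mem_nhds hε')
  filter_upwards [hfin, hB, h3] with i hi hBi h3i
  classical
  set w : Finset ℕ := u ∪ hi.toFinset with hw
  have hsum : ∑' j, t i j = ∑ j ∈ w, t i j := by
    refine tsum_eq_sum fun j hj => ?_
    by_contra hne
    exact hj (Finset.mem_union_right _ (hi.mem_toFinset.2 hne))
  have hsplit : ∑ j ∈ w, t i j = ∑ j ∈ w \ u, t i j + ∑ j ∈ u, t i j :=
    (Finset.sum_sdiff Finset.subset_union_left).symm
  have htail : q (∑ j ∈ w \ u, t i j) ≤ ε / 3 := by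
    have h5 : q (∑ j ∈ w \ u, t i j) ≤ ∑ j ∈ w \ u, q (t i j) :=
      Finset.le_sum_of_subadditive q (map_zero q).le (map_add_le_add q) _ _
    have h6 : ∑ j ∈ w \ u, q (t i j) ≤ ∑ j ∈ w \ u, B j := Finset.sum_le_sum fun j _ => hBi j
    have h7 : ∑ j ∈ w \ u, B j + ∑ j ∈ u, B j = ∑ j ∈ w, B j :=
      Finset.sum_sdiff Finset.subset_union_left
    have h8 : ∑ j ∈ w, B j ≤ ∑' j, B j := hBs.sum_le_tsum w fun j _ => hB0 j
    linarith
  have hdec : ∑' j, t i j - S = ∑ j ∈ w \ u, t i j +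
      ((∑ j ∈ u, t i j - ∑ j ∈ u, s j) + (∑ j ∈ u, s j - S)) := by
    rw [hsum, hsplit]; abel
  rw [hdec]
  refine (map_add_le_add q _ _).trans ?_
  have h9 := map_add_le_add q (∑ j ∈ u, t i j - ∑ j ∈ u, s j) (∑ j ∈ u, s j - S)
  linarith

end Sums

/-! ### Extension across a hyperplane -/

section Cutoff

/-- A smooth function which is `0` on `(-∞, (2 * τ + b) / 3]` and `1` on `[(τ + 2 * b) / 3, ∞)`. -/
def cutoff (τ b t : ℝ) : ℝ := Real.smoothTransition ((3 * t - (2 * τ + b)) / (b - τ))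

theorem contDiff_cutoff (τ b : ℝ) : ContDiff ℝ ∞ (cutoff τ b) := by
  unfold cutoff
  exact Real.smoothTransition.contDiff.comp (by fun_prop)

theorem cutoff_eq_zero {τ b t : ℝ} (hτb : τ < b) (ht : t ≤ (2 * τ + b) / 3) :
    cutoff τ b t = 0 :=
  Real.smoothTransition.zero_of_nonpos
    (div_nonpos_of_nonpos_of_nonneg (by linarith) (by linarith))

theorem cutoff_eq_one {τ b t : ℝ} (hτb : τ < b) (ht : (τ + 2 * b) / 3 ≤ t) :
    cutoff τ b t = 1 :=
  Real.smoothTransition.one_of_one_le (by rw [one_le_div (by linarith)]; linarith)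

end Cutoff

section Reflection

variable {H F : Type*} [AddCommGroup H] [Module ℝ H] [TopologicalSpace H]
  [IsTopologicalAddGroup H] [ContinuousSMul ℝ H]
  [AddCommGroup F] [Module ℝ F] [TopologicalSpace F]

/-- The pair `A` is the part `lam ≤ b` of the pair `A'`, and `A'` is invariant under translation in
the direction `e`, with `lam e = 1`, as long as `τ ≤ lam` holds after the translation. -/
structure IsReflectable (A A' : DomainPair H) (lam : H →L[ℝ] ℝ) (e : H) (τ b : ℝ) : Prop where
  lam_e : lam e = 1
  lt : τ < b
  mem_U : ∀ z, z ∈ A.U ↔ z ∈ A'.U ∧ lam z < b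
  mem_CU : ∀ z, z ∈ A.CU ↔ z ∈ A'.CU ∧ lam z ≤ b
  add_mem_U : ∀ z ∈ A'.U, ∀ t : ℝ, τ ≤ lam z + t → z + t • e ∈ A'.U
  add_mem_CU : ∀ z ∈ A'.CU, ∀ t : ℝ, τ ≤ lam z + t → z + t • e ∈ A'.CU

/-- The affine map that fixes the hyperplane `lam = b` and scales the distance to it by `-α`. -/
def reflect (lam : H →L[ℝ] ℝ) (e : H) (b α : ℝ) (z : H) : H := z + (-(1 + α) * (lam z - b)) • e

/-- The linear part of `reflect lam e b α`. -/
def reflectLin (lam : H →L[ℝ] ℝ) (e : H) (α : ℝ) : H →L[ℝ] H :=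
  ContinuousLinearMap.id ℝ H + (-(1 + α)) • lam.smulRight e

theorem reflectLin_apply (lam : H →L[ℝ] ℝ) (e : H) (α : ℝ) (v : H) :
    reflectLin lam e α v = v + (-(1 + α) * lam v) • e := by
  simp [reflectLin, smul_smul]

theorem reflect_add_smul (lam : H →L[ℝ] ℝ) (e : H) (b α : ℝ) (x v : H) (t : ℝ) :
    reflect lam e b α (x + t • v) = reflect lam e b α x + t • reflectLin lam e α v := by
  rw [reflectLin_apply, reflect, reflect, map_add, map_smul, smul_eq_mul]
  module

theorem continuous_reflect (lam : H →L[ℝ] ℝ) (e : H) (b α : ℝ) :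
    Continuous (reflect lam e b α) := by
  unfold reflect; fun_prop

omit [IsTopologicalAddGroup H] [ContinuousSMul ℝ H] in
theorem reflect_of_eq {lam : H →L[ℝ] ℝ} {b : ℝ} {z : H} (hz : lam z = b) (e : H) (α : ℝ) :
    reflect lam e b α z = z := by
  simp [reflect, hz]

variable {A A' : DomainPair H} {lam : H →L[ℝ] ℝ} {e : H} {τ b : ℝ}

omit [IsTopologicalAddGroup H] [ContinuousSMul ℝ H] in
theorem IsReflectable.lam_reflect (hA : IsReflectable A A' lam e τ b) (α : ℝ) (z : H) :
    lam (reflect lam e b α z) = b - α * (lam z - b) := by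
  rw [reflect, map_add, map_smul, hA.lam_e, smul_eq_mul]; ring

omit [IsTopologicalAddGroup H] [ContinuousSMul ℝ H] in
theorem IsReflectable.reflect_mem_CU (hA : IsReflectable A A' lam e τ b) {α : ℝ} (hα : 0 ≤ α)
    {z : H} (hz : z ∈ A'.CU) (hbz : b ≤ lam z) (hτ : τ ≤ lam (reflect lam e b α z)) :
    reflect lam e b α z ∈ A.CU := by
  refine (hA.mem_CU _).2 ⟨hA.add_mem_CU z hz _ ?_, ?_⟩
  · rw [hA.lam_reflect] at hτ
    linarith
  · rw [hA.lam_reflect]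
    linarith [mul_nonneg hα (sub_nonneg.2 hbz)]

omit [IsTopologicalAddGroup H] [ContinuousSMul ℝ H] in
theorem IsReflectable.reflect_mem_U (hA : IsReflectable A A' lam e τ b) {α : ℝ} (hα : 0 < α)
    {z : H} (hz : z ∈ A'.U) (hbz : b < lam z) (hτ : τ ≤ lam (reflect lam e b α z)) :
    reflect lam e b α z ∈ A.U := by
  refine (hA.mem_U _).2 ⟨hA.add_mem_U z hz _ ?_, ?_⟩
  · rw [hA.lam_reflect] at hτ
    linarith
  · rw [hA.lam_reflect]
    linarith [mul_pos hα (sub_pos.2 hbz)]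

/-- The `j`-th term of the reflection formula, for a jet `P` which vanishes for `lam < σ`. The case
distinction matters since reflected points with `lam < σ` may lie outside of the domain of `P`. -/
def reflectTerm (lam : H →L[ℝ] ℝ) (e : H) (σ b : ℝ) (c : ℕ → ℝ)
    (P : (ℓ : ℕ) → H → (Fin ℓ → H) → F) (j ℓ : ℕ) (z : H) (v : Fin ℓ → H) : F :=
  if lam (reflect lam e b (2 ^ j) z) < σ then 0
  else c j • P ℓ (reflect lam e b (2 ^ j) z) (reflectLin lam e (2 ^ j) ∘ v)

variable {σ : ℝ} {c : ℕ → ℝ} {k : ℕ∞} {P : (ℓ : ℕ) → H → (Fin ℓ → H) → F}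

theorem IsReflectable.isJet_reflectTerm (hA : IsReflectable A A' lam e τ b)
    [ContinuousConstSMul ℝ F] (hσ : τ < σ) (c : ℕ → ℝ) (hP : IsJet k A.U A.CU P)
    (hP0 : ∀ ℓ : ℕ, (ℓ : ℕ∞) ≤ k → ∀ x ∈ A.CU, lam x < σ → ∀ v, P ℓ x v = 0) (j : ℕ) :
    IsJet k (A'.U ∩ {z | b < lam z}) (A'.CU ∩ {z | b ≤ lam z})
      (reflectTerm lam e σ b c P j) := by
  have hα : (0 : ℝ) < 2 ^ j := by positivity
  have hTc := continuous_reflect lam e b (2 ^ j)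
  refine IsJet.of_local (inter_subset_inter A'.subset fun z (hz : b < lam z) => show b ≤ lam z from hz.le) ?_
    (A'.isOpen.inter (isOpen_lt continuous_const lam.continuous))
  rintro z ⟨hz, hbz⟩
  by_cases hlt : lam (reflect lam e b (2 ^ j) z) < σ
  · refine ⟨{z | lam (reflect lam e b (2 ^ j) z) < σ},
      isOpen_lt (lam.continuous.comp hTc) continuous_const, hlt, _, isJet_zero k _ _, ?_⟩
    exact fun ℓ _ x hx v => if_pos hx.2
  · refine ⟨{z | τ < lam (reflect lam e b (2 ^ j) z)},
      isOpen_lt continuous_const (lam.continuous.comp hTc), hσ.trans_le (not_lt.1 hlt), _,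
      (hP.comp_affine hTc (reflectLin lam e (2 ^ j)) (reflect_add_smul lam e b (2 ^ j))
        (fun x hx => hA.reflect_mem_U hα hx.1.1 hx.1.2 (le_of_lt hx.2))
        (fun x hx => hA.reflect_mem_CU hα.le hx.1.1 hx.1.2 (le_of_lt hx.2))).const_smul (c j), ?_⟩
    intro ℓ hℓ x hx v
    rw [reflectTerm]
    split_ifs with h
    · rw [hP0 ℓ hℓ _ (hA.reflect_mem_CU hα.le hx.1.1 hx.1.2 (le_of_lt hx.2)) h, smul_zero]
    · rfl

omit [TopologicalSpace F] in
theorem IsReflectable.reflectTerm_eq_zero (hA : IsReflectable A A' lam e τ b) {δ : ℝ} {z : H}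
    (hδ : 0 ≤ δ) (hz : b + δ ≤ lam z) {j : ℕ} (hj : b - σ < j * δ) (ℓ : ℕ) (v : Fin ℓ → H) :
    reflectTerm lam e σ b c P j ℓ z v = 0 := by
  refine if_pos ?_
  rw [hA.lam_reflect]
  have h1 : (j : ℝ) ≤ 2 ^ j := by exact_mod_cast Nat.lt_two_pow_self.le
  have h2 : (j : ℝ) * δ ≤ 2 ^ j * (lam z - b) :=
    mul_le_mul h1 (by linarith) hδ (by positivity)
  linarith

omit [TopologicalSpace F] in
/-- The sum over all reflections is locally finite for `b < lam`. -/
theorem IsReflectable.exists_forall_reflectTerm_eq_zero (hA : IsReflectable A A' lam e τ b)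
    (σ : ℝ) {δ : ℝ} (hδ : 0 < δ) : ∃ N : ℕ, ∀ z, b + δ ≤ lam z → ∀ j ∉ Finset.range N,
      ∀ (c : ℕ → ℝ) (P : (ℓ : ℕ) → H → (Fin ℓ → H) → F) (ℓ : ℕ) (v : Fin ℓ → H),
        reflectTerm lam e σ b c P j ℓ z v = 0 := by
  obtain ⟨N, hN⟩ := exists_nat_gt ((b - σ) / δ)
  refine ⟨N, fun z hz j hj c P ℓ v => hA.reflectTerm_eq_zero hδ.le hz ?_ ℓ v⟩
  rw [div_lt_iff₀ hδ] at hN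
  have hj' : (N : ℝ) ≤ j := by exact_mod_cast not_lt.1 fun h => hj (Finset.mem_range.2 h)
  exact hN.trans_le (mul_le_mul_of_nonneg_right hj' hδ.le)

variable [IsTopologicalAddGroup F] [ContinuousSMul ℝ F]

theorem IsReflectable.isJet_tsum_reflectTerm (hA : IsReflectable A A' lam e τ b)
    (hσ : τ < σ) (c : ℕ → ℝ) (hP : IsJet k A.U A.CU P)
    (hP0 : ∀ ℓ : ℕ, (ℓ : ℕ∞) ≤ k → ∀ x ∈ A.CU, lam x < σ → ∀ v, P ℓ x v = 0) :
    IsJet k (A'.U ∩ {z | b < lam z}) (A'.CU ∩ {z | b < lam z})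
      (fun ℓ z v => ∑' j, reflectTerm lam e σ b c P j ℓ z v) := by
  refine IsJet.of_local (inter_subset_inter_left _ A'.subset) ?_
    (A'.isOpen.inter (isOpen_lt continuous_const lam.continuous))
  rintro z ⟨hz, hbz⟩
  obtain ⟨δ, hδ, hδz⟩ : ∃ δ > 0, b + δ < lam z :=
    ⟨(lam z - b) / 2, half_pos (sub_pos.2 hbz), by have : b < lam z := hbz; linarith⟩
  obtain ⟨N, hN⟩ := hA.exists_forall_reflectTerm_eq_zero (F := F) σ hδ
  refine ⟨{z | b + δ < lam z}, isOpen_lt continuous_const lam.continuous, hδz, _,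
    IsJet.sum (Finset.range N) fun j _ => (hA.isJet_reflectTerm hσ c hP hP0 j).mono
      inter_subset_left fun x hx => ⟨hx.1.1, show b ≤ lam x from le_of_lt hx.1.2⟩, ?_⟩
  exact fun ℓ _ x hx v => tsum_eq_sum fun j hj => hN x (le_of_lt hx.2) j hj c P ℓ v

variable [LocallyConvexSpace ℝ F] [T2Space F]

/-- Near the hyperplane, the `j`-th reflection term of order `ℓ` is bounded, with respect to each
continuous seminorm, by a multiple of `|c j| * (2 ^ j) ^ ℓ`. By homogeneity, a factor `2 ^ j` can be
moved out of each of the `ℓ` vectors; what remains lies in the image of a compact set. -/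
theorem IsReflectable.exists_seminorm_reflectTerm_le (hA : IsReflectable A A' lam e τ b)
    (hσ : τ < σ) (c : ℕ → ℝ) (hP : IsJet k A.U A.CU P) {ℓ : ℕ} (hℓ : (ℓ : ℕ∞) ≤ k)
    {q : Seminorm ℝ F} (hq : Continuous q) {z₀ : H} (hz₀ : z₀ ∈ A'.CU) (hb : lam z₀ = b)
    (v₀ : Fin ℓ → H) : ∃ M : ℝ, 0 ≤ M ∧
      ∀ᶠ p : H × (Fin ℓ → H) in 𝓝[(A'.CU ∩ {z | b ≤ lam z}) ×ˢ univ] (z₀, v₀),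
        ∀ j, q (reflectTerm lam e σ b c P j ℓ p.1 p.2) ≤ |c j| * (2 ^ j) ^ ℓ * M := by
  -- The parameters in `K` stand for `2 ^ j * (lam z - b)`, the distance of the reflected point to the
  -- hyperplane, and for `(2 ^ j)⁻¹`.
  set K : Set (ℝ × ℝ) := Icc 0 (b - τ) ×ˢ Icc 0 1 with hK
  have hKc : IsCompact K := isCompact_Icc.prod isCompact_Icc
  set S : Set (H × (Fin ℓ → H)) := (A'.CU ∩ {z | b ≤ lam z}) ×ˢ univ with hS
  set g : (H × (Fin ℓ → H)) × (ℝ × ℝ) → H × (Fin ℓ → H) := fun y =>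
    (y.1.1 + (-(lam y.1.1 - b + y.2.1)) • e,
      fun i => y.2.2 • y.1.2 i + (-(y.2.2 + 1) * lam (y.1.2 i)) • e) with hg
  have hgc : Continuous g := by
    refine Continuous.prodMk (by fun_prop) (continuous_pi fun i => ?_)
    fun_prop
  have hG : ContinuousOn (fun y => q (P ℓ (g y).1 (g y).2)) (S ×ˢ K) := by
    refine hq.comp_continuousOn ((hP.continuousOn ℓ hℓ).comp hgc.continuousOn ?_)
    rintro ⟨⟨z, v⟩, s, β⟩ ⟨⟨⟨hz, hbz⟩, -⟩, ⟨hs0, hs1⟩, -⟩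
    refine ⟨(hA.mem_CU _).2 ⟨hA.add_mem_CU z hz _ ?_, ?_⟩, mem_univ _⟩
    · dsimp only at hs1 ⊢
      linarith
    · dsimp only at hs0 ⊢
      simp only [hg, map_add, map_smul, hA.lam_e, smul_eq_mul]
      linarith
  have hmem₀ : ((z₀, v₀) : H × (Fin ℓ → H)) ∈ S := ⟨⟨hz₀, hb.ge⟩, mem_univ _⟩
  obtain ⟨M, hM⟩ : ∃ M, ∀ κ ∈ K, q (P ℓ (g ((z₀, v₀), κ)).1 (g ((z₀, v₀), κ)).2) ≤ M := by
    have h1 : ContinuousOn (fun κ => q (P ℓ (g ((z₀, v₀), κ)).1 (g ((z₀, v₀), κ)).2)) K :=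
      hG.comp (f := fun κ : ℝ × ℝ => ((z₀, v₀), κ)) (by fun_prop) fun κ hκ => ⟨hmem₀, hκ⟩
    obtain ⟨M, hM⟩ := hKc.bddAbove_image h1
    exact ⟨M, fun κ hκ => hM (mem_image_of_mem _ hκ)⟩
  have hM0 : 0 ≤ M := (apply_nonneg q _).trans (hM (0, 0)
    ⟨⟨le_rfl, by linarith [hA.lt]⟩, le_rfl, zero_le_one⟩)
  refine ⟨M + 1, by linarith, ?_⟩
  have hev : ∀ᶠ p in 𝓝 (z₀, v₀), ∀ κ ∈ K, p ∈ S → κ ∈ K →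
      q (P ℓ (g (p, κ)).1 (g (p, κ)).2) ≤ M + 1 := by
    refine hKc.eventually_forall_of_forall_eventually
      (P := fun p κ => p ∈ S → κ ∈ K → q (P ℓ (g (p, κ)).1 (g (p, κ)).2) ≤ M + 1) fun κ hκ => ?_
    have h1 := (hG ((z₀, v₀), κ) ⟨hmem₀, hκ⟩).eventually
      (gt_mem_nhds (lt_of_le_of_lt (hM κ hκ) (lt_add_one M)))
    rw [eventually_nhdsWithin_iff] at h1
    filter_upwards [h1] with y hy h2 h3
    exact (hy ⟨h2, h3⟩).le
  rw [eventually_nhdsWithin_iff]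
  filter_upwards [hev] with ⟨z, v⟩ h hzv j
  have hα1 : (1 : ℝ) ≤ 2 ^ j := one_le_pow₀ (by norm_num)
  have hα : (0 : ℝ) < 2 ^ j := by positivity
  rw [reflectTerm]
  split_ifs with hlt
  · rw [map_zero]; positivity
  have hτ : τ ≤ lam (reflect lam e b (2 ^ j) z) := hσ.le.trans (not_lt.1 hlt)
  have hTz := hA.reflect_mem_CU hα.le hzv.1.1 hzv.1.2 hτ
  obtain ⟨m, hm⟩ := hP.exists_multilinearMap A.isOpen A.subset A.subset_closure hℓ hTz
  have hbz : 0 ≤ lam z - b := sub_nonneg.2 hzv.1.2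
  rw [hA.lam_reflect] at hτ
  have hκ : ((2 ^ j * (lam z - b), (2 ^ j)⁻¹) : ℝ × ℝ) ∈ K :=
    ⟨⟨mul_nonneg hα.le hbz, by dsimp only; linarith⟩, by positivity, inv_le_one_of_one_le₀ hα1⟩
  have hbound := h _ hκ hzv hκ
  have hg1 : (g ((z, v), (2 ^ j * (lam z - b), (2 ^ j)⁻¹))).1 = reflect lam e b (2 ^ j) z := by
    simp only [hg, reflect]
    congr 2
    ring
  have hg2 : reflectLin lam e (2 ^ j) ∘ v =
      fun i => (2 : ℝ) ^ j • (g ((z, v), (2 ^ j * (lam z - b), (2 ^ j)⁻¹))).2 i := by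
    ext i
    simp only [hg, Function.comp, reflectLin_apply, smul_add, smul_smul]
    congr 2
    · rw [mul_inv_cancel₀ hα.ne', one_smul]
    · field_simp
  rw [hg1, ← hm] at hbound
  rw [← hm, hg2, m.map_smul_univ (fun _ => (2 : ℝ) ^ j), Finset.prod_const, Finset.card_univ,
    Fintype.card_fin, smul_smul, map_smul_eq_mul, Real.norm_eq_abs, abs_mul,
    abs_of_pos (pow_pos hα ℓ)]
  exact mul_le_mul_of_nonneg_left hbound (by positivity)

/-- On the hyperplane, the reflection terms sum up to the given jet. -/
theorem IsReflectable.hasSum_reflectTerm (hA : IsReflectable A A' lam e τ b) (hσb : σ ≤ b)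
    (hc : ∀ m : ℕ, HasSum (fun j => c j * (2 ^ j) ^ m) ((-1) ^ m)) (hP : IsJet k A.U A.CU P)
    {ℓ : ℕ} (hℓ : (ℓ : ℕ∞) ≤ k) {z : H} (hz : z ∈ A'.CU) (hb : lam z = b) (v : Fin ℓ → H) :
    HasSum (fun j => reflectTerm lam e σ b c P j ℓ z v) (P ℓ z v) := by
  obtain ⟨m, hm⟩ := hP.exists_multilinearMap A.isOpen A.subset A.subset_closure hℓ
    ((hA.mem_CU z).2 ⟨hz, hb.le⟩)
  have h := hasSum_smul_multilinear hc m (fun i => -lam (v i) • e) (fun i => v i + -lam (v i) • e)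
  have h1 : (fun i => (-1 : ℝ) • (-lam (v i) • e) + (v i + -lam (v i) • e)) = v := by
    ext i; module
  have h2 : ∀ j, reflectTerm lam e σ b c P j ℓ z v =
      c j • m (fun i => (2 : ℝ) ^ j • (-lam (v i) • e) + (v i + -lam (v i) • e)) := by
    intro j
    rw [reflectTerm, reflect_of_eq hb, if_neg (by rw [hb]; exact not_lt.2 hσb), hm]
    congr 2
    ext i
    rw [Function.comp, reflectLin_apply]
    module
  simp only [h2]
  rwa [h1, hm] at h

/-- The jet `Φ` for `lam ≤ b`, and the sum of the reflections of `P` for `b < lam`. -/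
def reflectExtend (lam : H →L[ℝ] ℝ) (e : H) (σ b : ℝ) (c : ℕ → ℝ)
    (Φ P : (ℓ : ℕ) → H → (Fin ℓ → H) → F) (ℓ : ℕ) (z : H) (v : Fin ℓ → H) : F :=
  if lam z ≤ b then Φ ℓ z v else ∑' j, reflectTerm lam e σ b c P j ℓ z v

theorem IsReflectable.isJet_reflectExtend (hA : IsReflectable A A' lam e τ b)
    (hσ : τ < σ) (hσb : σ ≤ b) (hcs : ∀ m : ℕ, Summable fun j => |c j| * (2 ^ j) ^ m)
    (hc : ∀ m : ℕ, HasSum (fun j => c j * (2 ^ j) ^ m) ((-1) ^ m))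
    {Φ : (ℓ : ℕ) → H → (Fin ℓ → H) → F}
    (hΦ : IsJet k A.U A.CU Φ) (hP : IsJet k A.U A.CU P)
    (hP0 : ∀ ℓ : ℕ, (ℓ : ℕ∞) ≤ k → ∀ x ∈ A.CU, lam x < σ → ∀ v, P ℓ x v = 0)
    (hPb : ∀ ℓ : ℕ, (ℓ : ℕ∞) ≤ k → ∀ x ∈ A.CU, lam x = b → ∀ v, P ℓ x v = Φ ℓ x v) :
    IsJet k A'.U A'.CU (reflectExtend lam e σ b c Φ P) := by
  have hoff : IsJet k (A'.U ∩ {z | lam z ≠ b}) (A'.CU ∩ {z | lam z ≠ b})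
      (reflectExtend lam e σ b c Φ P) := by
    refine IsJet.of_local (inter_subset_inter_left _ A'.subset) ?_
      (A'.isOpen.inter (isOpen_ne_fun lam.continuous continuous_const))
    rintro z ⟨hz, hne⟩
    rcases lt_or_gt_of_ne hne with hlt | hlt
    · refine ⟨{z | lam z < b}, isOpen_lt lam.continuous continuous_const, hlt, Φ,
        hΦ.mono (fun x hx => (hA.mem_U x).2 ⟨hx.1.1, hx.2⟩)
          (fun x hx => (hA.mem_CU x).2 ⟨hx.1.1, le_of_lt hx.2⟩), ?_⟩
      exact fun ℓ _ x hx v => if_pos (le_of_lt hx.2)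
    · refine ⟨{z | b < lam z}, isOpen_lt continuous_const lam.continuous, hlt, _,
        (hA.isJet_tsum_reflectTerm hσ c hP hP0).mono (inter_subset_inter_left _ inter_subset_left)
          (inter_subset_inter_left _ inter_subset_left), ?_⟩
      exact fun ℓ _ x hx v => if_neg (not_le.2 hx.2)
  have hcont : ∀ ℓ : ℕ, (ℓ : ℕ∞) ≤ k → ContinuousOn
      (fun p : H × (Fin ℓ → H) => reflectExtend lam e σ b c Φ P ℓ p.1 p.2) (A'.CU ×ˢ univ) := by
    rintro ℓ hℓ ⟨z, v⟩ ⟨hz, -⟩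
    rcases ne_or_eq (lam z) b with hne | heq
    · refine ((hoff.continuousOn ℓ hℓ) (z, v) ⟨⟨hz, hne⟩, mem_univ _⟩).mono_of_mem_nhdsWithin ?_
      have hO : IsOpen {p : H × (Fin ℓ → H) | lam p.1 ≠ b} :=
        isOpen_ne_fun (by fun_prop) continuous_const
      filter_upwards [self_mem_nhdsWithin, mem_nhdsWithin_of_mem_nhds
        (hO.mem_nhds (x := (z, v)) hne)] with p hp hpO
      exact ⟨⟨hp.1, hpO⟩, mem_univ _⟩
    · have hzv : reflectExtend lam e σ b c Φ P ℓ z v = Φ ℓ z v := if_pos heq.le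
      have hzCU : z ∈ A.CU := (hA.mem_CU z).2 ⟨hz, heq.le⟩
      have hle : ContinuousWithinAt
          (fun p : H × (Fin ℓ → H) => reflectExtend lam e σ b c Φ P ℓ p.1 p.2)
          (A.CU ×ˢ univ) (z, v) :=
        ((hΦ.continuousOn ℓ hℓ) (z, v) ⟨hzCU, mem_univ _⟩).congr
          (fun p hp => if_pos ((hA.mem_CU p.1).1 hp.1).2) hzv
      have hgt : ContinuousWithinAt
          (fun p : H × (Fin ℓ → H) => reflectExtend lam e σ b c Φ P ℓ p.1 p.2)
          ((A'.CU ∩ {z | b < lam z}) ×ˢ univ) (z, v) := by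
        have hsub : (A'.CU ∩ {z | b < lam z}) ×ˢ (univ : Set (Fin ℓ → H)) ⊆
            (A'.CU ∩ {z | b ≤ lam z}) ×ˢ univ :=
          prod_mono (inter_subset_inter_right _ fun x (hx : b < lam x) => show b ≤ lam x from hx.le)
            subset_rfl
        have key : Tendsto
            (fun p : H × (Fin ℓ → H) => ∑' j, reflectTerm lam e σ b c P j ℓ p.1 p.2)
            (𝓝[(A'.CU ∩ {z | b < lam z}) ×ˢ univ] (z, v)) (𝓝 (P ℓ z v)) := by
          refine tendsto_tsum_of_seminorm_le ?_
            (hA.hasSum_reflectTerm hσb hc hP hℓ hz heq v) (fun j => ?_) fun q hq => ?_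
          · filter_upwards [self_mem_nhdsWithin] with p hp
            obtain ⟨N, hN⟩ := hA.exists_forall_reflectTerm_eq_zero (F := F) σ
              (sub_pos.2 (show b < lam p.1 from hp.1.2))
            refine (Finset.range N).finite_toSet.subset fun j hj => ?_
            by_contra hjN
            exact hj (hN p.1 (by linarith) j hjN c P ℓ p.2)
          · exact ((hA.isJet_reflectTerm hσ c hP hP0 j).continuousOn ℓ hℓ (z, v)
              ⟨⟨hz, heq.ge⟩, mem_univ _⟩).mono hsub
          · obtain ⟨M, hM0, hM⟩ := hA.exists_seminorm_reflectTerm_le hσ c hP hℓ hq hz heq v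
            exact ⟨_, fun j => by positivity, (hcs ℓ).mul_right M,
              hM.filter_mono (nhdsWithin_mono _ hsub)⟩
        rw [ContinuousWithinAt, hzv, ← hPb ℓ hℓ z hzCU heq v]
        refine key.congr' ?_
        filter_upwards [self_mem_nhdsWithin] with p hp
        exact (if_neg (not_le.2 hp.1.2)).symm
      refine (hle.union hgt).mono fun p hp => ?_
      rcases le_or_gt (lam p.1) b with h | h
      · exact Or.inl ⟨(hA.mem_CU p.1).2 ⟨hp.1, h⟩, mem_univ _⟩
      · exact Or.inr ⟨⟨hp.1, h⟩, mem_univ _⟩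
  have hcont' : ∀ ℓ : ℕ, (ℓ : ℕ∞) ≤ k → ∀ v : Fin ℓ → H,
      ContinuousOn (fun z => reflectExtend lam e σ b c Φ P ℓ z v) A'.U := fun ℓ hℓ v =>
    (hcont ℓ hℓ).comp (f := fun z : H => (z, v)) (by fun_prop)
      fun z hz => ⟨A'.subset hz, mem_univ _⟩
  refine ⟨hcont, fun ℓ hℓ x hx v w => ?_⟩
  rcases ne_or_eq (lam x) b with hne | heq
  · exact hoff.hasDirDeriv ℓ hℓ x ⟨hx, hne⟩ v w
  · exact HasDirDeriv.of_off_hyperplane A'.isOpen lam hA.lam_e hx (hcont' ℓ hℓ.le v)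
      (hcont' (ℓ + 1) (natCast_succ_le_of_lt hℓ) _)
      fun z hz hzx => hoff.hasDirDeriv ℓ hℓ z ⟨hz, by rwa [← heq]⟩ v w

end Reflection

/-! ### The extension operator of a reflection -/

section Operator

variable {H F : Type*} [AddCommGroup H] [Module ℝ H] [TopologicalSpace H]
  [IsTopologicalAddGroup H] [ContinuousSMul ℝ H]
  [AddCommGroup F] [Module ℝ F] [TopologicalSpace F] [IsTopologicalAddGroup F]
  [ContinuousSMul ℝ F]

/-- The jet of the extension of a map with jet `Φ`: the reflections are applied to the product with
a cutoff function. -/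
def cutoffExtend (lam : H →L[ℝ] ℝ) (e : H) (τ b : ℝ) (c : ℕ → ℝ)
    (Φ : (ℓ : ℕ) → H → (Fin ℓ → H) → F) : (ℓ : ℕ) → H → (Fin ℓ → H) → F :=
  reflectExtend lam e ((2 * τ + b) / 3) b c Φ
    (fun ℓ z v => leibniz lam (cutoff τ b) Φ ℓ 0 0 ![] z v)

variable {A A' : DomainPair H} {lam : H →L[ℝ] ℝ} {e : H} {τ b : ℝ}

omit [IsTopologicalAddGroup F] [ContinuousSMul ℝ F] in
/-- The value of the extension at a point is a finite linear combination of values of the given map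
on the line through this point in the direction `e`. -/
theorem IsReflectable.exists_cutoffExtend_eq_sum (hA : IsReflectable A A' lam e τ b) (c : ℕ → ℝ)
    {z : H} (hz : z ∈ A'.U) : ∃ (N : ℕ) (w : ℕ → ℝ) (p : ℕ → H),
      (∀ j, w j ≠ 0 → p j ∈ A'.U ∧ lam (p j) ≤ b ∧ ∃ t : ℝ, p j = z + t • e) ∧
      ∀ Φ : (ℓ : ℕ) → H → (Fin ℓ → H) → F,
        cutoffExtend lam e τ b c Φ 0 z ![] = ∑ j ∈ Finset.range N, w j • Φ 0 (p j) ![] := by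
  have hlt := hA.lt
  rcases le_or_gt (lam z) b with hzb | hzb
  · refine ⟨1, fun _ => 1, fun _ => z, fun _ _ => ⟨hz, hzb, 0, by simp⟩, fun Φ => ?_⟩
    rw [cutoffExtend, reflectExtend, if_pos hzb]
    simp
  · obtain ⟨N, hN⟩ := hA.exists_forall_reflectTerm_eq_zero (F := F) ((2 * τ + b) / 3)
      (sub_pos.2 hzb)
    refine ⟨N, fun j => if lam (reflect lam e b (2 ^ j) z) < (2 * τ + b) / 3 then 0
      else c j * cutoff τ b (lam (reflect lam e b (2 ^ j) z)),
      fun j => reflect lam e b (2 ^ j) z, fun j hj => ?_, fun Φ => ?_⟩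
    · have h1 : ¬ lam (reflect lam e b (2 ^ j) z) < (2 * τ + b) / 3 := fun h => hj (if_pos h)
      have h2 := (hA.mem_U _).1 (hA.reflect_mem_U (α := 2 ^ j) (by positivity) hz hzb
        (by linarith [not_lt.1 h1]))
      exact ⟨h2.1, h2.2.le, _, rfl⟩
    · rw [cutoffExtend, reflectExtend, if_neg (not_le.2 hzb),
        tsum_eq_sum fun j hj => hN z (by linarith) j hj c _ 0 ![]]
      refine Finset.sum_congr rfl fun j _ => ?_
      by_cases h : lam (reflect lam e b (2 ^ j) z) < (2 * τ + b) / 3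
      · simp [reflectTerm, h]
      · simp [reflectTerm, h, leibniz, smul_smul]

omit [IsTopologicalAddGroup F] [ContinuousSMul ℝ F] in
theorem IsReflectable.cutoffExtend_eq_zero (hA : IsReflectable A A' lam e τ b) (c : ℕ → ℝ)
    (Φ : (ℓ : ℕ) → H → (Fin ℓ → H) → F) {z : H} (hz : 2 * b - τ ≤ lam z) {ℓ : ℕ}
    (v : Fin ℓ → H) : cutoffExtend lam e τ b c Φ ℓ z v = 0 := by
  have hlt := hA.lt
  rw [cutoffExtend, reflectExtend, if_neg (by linarith)]
  refine (tsum_congr fun j => ?_).trans tsum_zero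
  refine if_pos ?_
  rw [hA.lam_reflect]
  have h1 : (1 : ℝ) ≤ 2 ^ j := one_le_pow₀ (by norm_num)
  nlinarith

variable [LocallyConvexSpace ℝ F] [T2Space F] {k : ℕ∞}

theorem IsReflectable.isJet_cutoffExtend (hA : IsReflectable A A' lam e τ b) {c : ℕ → ℝ}
    (hcs : ∀ m : ℕ, Summable fun j => |c j| * (2 ^ j) ^ m)
    (hc : ∀ m : ℕ, HasSum (fun j => c j * (2 ^ j) ^ m) ((-1) ^ m))
    {Φ : (ℓ : ℕ) → H → (Fin ℓ → H) → F} (hΦ : IsJet k A.U A.CU Φ) :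
    IsJet k A'.U A'.CU (cutoffExtend lam e τ b c Φ) := by
  have hlt := hA.lt
  have hP := hΦ.leibniz A.isOpen A.subset lam (contDiff_cutoff τ b)
  refine hA.isJet_reflectExtend (by linarith) (by linarith) hcs hc hΦ hP ?_ ?_
  · intro ℓ hℓ x hx hxσ v
    refine hP.eq_of_eq_zero (isJet_zero k A.U A.CU) A.isOpen A.subset A.subset_closure
      (O := {z | lam z < (2 * τ + b) / 3}) (isOpen_lt lam.continuous continuous_const)
      (fun z hz v => ?_) hℓ ⟨hx, hxσ⟩ v
    simp [leibniz, cutoff_eq_zero hlt (le_of_lt hz.2)]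
  · intro ℓ hℓ x hx hxb v
    refine hP.eq_of_eq_zero hΦ A.isOpen A.subset A.subset_closure
      (O := {z | (τ + 2 * b) / 3 < lam z}) (isOpen_lt continuous_const lam.continuous)
      (fun z hz v => ?_) hℓ ⟨hx, show (τ + 2 * b) / 3 < lam x by linarith⟩ v
    rw [Subsingleton.elim v ![]]
    simp [leibniz, cutoff_eq_one hlt (le_of_lt hz.2)]

omit [LocallyConvexSpace ℝ F] in
theorem CkExt.ext_add {A : DomainPair H} (f g : CkExt F k A) {ℓ : ℕ} (hℓ : (ℓ : ℕ∞) ≤ k) {x : H}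
    (hx : x ∈ A.CU) (v : Fin ℓ → H) :
    CkExt.ext (f + g) ℓ x v = CkExt.ext f ℓ x v + CkExt.ext g ℓ x v := by
  refine (CkExt.isJet (f + g)).eq_of_eq_zero ((CkExt.isJet f).add (CkExt.isJet g)) A.isOpen A.subset A.subset_closure
    isOpen_univ (fun z hz v => ?_) hℓ ⟨hx, mem_univ _⟩ v
  simp only [CkExt.ext_zero_apply _ hz.1]
  rfl

omit [LocallyConvexSpace ℝ F] in
theorem CkExt.ext_smul {A : DomainPair H} (r : ℝ) (f : CkExt F k A) {ℓ : ℕ} (hℓ : (ℓ : ℕ∞) ≤ k)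
    {x : H} (hx : x ∈ A.CU) (v : Fin ℓ → H) :
    CkExt.ext (r • f) ℓ x v = r • CkExt.ext f ℓ x v := by
  refine (CkExt.isJet (r • f)).eq_of_eq_zero ((CkExt.isJet f).const_smul r) A.isOpen A.subset A.subset_closure
    isOpen_univ (fun z hz v => ?_) hℓ ⟨hx, mem_univ _⟩ v
  rw [CkExt.ext_zero_apply _ hz.1, CkExt.ext_zero_apply _ hz.1]
  rfl

/-- The extension operator of a reflection, as a linear map. The last property says that zero sets
which are unions of lines in the direction `e` are preserved. -/
theorem IsReflectable.exists_extension (hA : IsReflectable A A' lam e τ b) (k : ℕ∞) :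
    ∃ T : CkExt F k A →ₗ[ℝ] CkExt F k A',
      (∀ (f : CkExt F k A) z (hz : z ∈ A.U) (hz' : z ∈ A'.U),
        (T f).1 ⟨z, hz'⟩ = f.1 ⟨z, hz⟩) ∧
      (∀ (f : CkExt F k A) z (hz' : z ∈ A'.U), 2 * b - τ ≤ lam z → (T f).1 ⟨z, hz'⟩ = 0) ∧
      ∀ (f : CkExt F k A) (Z : Set H), (∀ z ∈ Z, ∀ t : ℝ, z + t • e ∈ Z) →
        (∀ z (hz : z ∈ A.U), z ∈ Z → f.1 ⟨z, hz⟩ = 0) →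
        ∀ z (hz' : z ∈ A'.U), z ∈ Z → (T f).1 ⟨z, hz'⟩ = 0 := by
  obtain ⟨c, hc⟩ := exists_reflection_coeff
  have hmem : ∀ f : CkExt F k A,
      (fun z : A'.U => cutoffExtend lam e τ b c (CkExt.ext f) 0 z ![]) ∈ CkExt F k A' := fun f =>
    (hA.isJet_cutoffExtend (fun m => (hc m).1) (fun m => (hc m).2) (CkExt.isJet f)).mem_ckExt
      fun x v => by rw [Subsingleton.elim v ![]]
  refine ⟨{
    toFun := fun f => ⟨_, hmem f⟩
    map_add' := fun f g => ?_
    map_smul' := fun r f => ?_ }, ?_, ?_, ?_⟩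
  · ext z
    obtain ⟨N, w, p, hp, hsum⟩ := hA.exists_cutoffExtend_eq_sum (F := F) c z.2
    change cutoffExtend lam e τ b c (CkExt.ext (f + g)) 0 z ![] =
      cutoffExtend lam e τ b c (CkExt.ext f) 0 z ![] +
        cutoffExtend lam e τ b c (CkExt.ext g) 0 z ![]
    rw [hsum, hsum, hsum, ← Finset.sum_add_distrib]
    refine Finset.sum_congr rfl fun j _ => ?_
    rcases eq_or_ne (w j) 0 with hw | hw
    · simp [hw]
    · rw [CkExt.ext_add f g (by simp) ((hA.mem_CU _).2 ⟨A'.subset (hp j hw).1, (hp j hw).2.1⟩),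
        smul_add]
  · ext z
    obtain ⟨N, w, p, hp, hsum⟩ := hA.exists_cutoffExtend_eq_sum (F := F) c z.2
    change cutoffExtend lam e τ b c (CkExt.ext (r • f)) 0 z ![] =
      r • cutoffExtend lam e τ b c (CkExt.ext f) 0 z ![]
    rw [hsum, hsum, Finset.smul_sum]
    refine Finset.sum_congr rfl fun j _ => ?_
    rcases eq_or_ne (w j) 0 with hw | hw
    · simp [hw]
    · rw [CkExt.ext_smul r f (by simp) ((hA.mem_CU _).2 ⟨A'.subset (hp j hw).1, (hp j hw).2.1⟩),
        smul_comm]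
  · intro f z hz hz'
    change cutoffExtend lam e τ b c (CkExt.ext f) 0 z ![] = _
    rw [cutoffExtend, reflectExtend, if_pos ((hA.mem_U z).1 hz).2.le, CkExt.ext_zero_apply f hz]
  · exact fun f z hz' hz => hA.cutoffExtend_eq_zero c (CkExt.ext f) hz ![]
  · intro f Z hZ hf z hz' hzZ
    have hext : ∀ x ∈ A'.U, x ∈ Z → lam x ≤ b → CkExt.ext f 0 x ![] = 0 := by
      intro x hx hxZ hxb
      have hlim : Tendsto (fun s : ℝ => x + (-s) • e) (𝓝[>] 0) (𝓝 x) := by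
        have h1 : Continuous fun s : ℝ => x + (-s) • e := by fun_prop
        have h2 := h1.tendsto 0
        rw [neg_zero, zero_smul, add_zero] at h2
        exact h2.mono_left nhdsWithin_le_nhds
      have hU : ∀ᶠ s : ℝ in 𝓝[>] 0, x + (-s) • e ∈ A.U := by
        filter_upwards [hlim.eventually (A'.isOpen.mem_nhds hx), self_mem_nhdsWithin] with s hs hs0
        refine (hA.mem_U _).2 ⟨hs, ?_⟩
        have : (0 : ℝ) < s := hs0
        rw [map_add, map_smul, hA.lam_e, smul_eq_mul]
        linarith
      have hcont := ((CkExt.isJet f).continuousOn_apply (by simp) ![]) x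
        ((hA.mem_CU x).2 ⟨A'.subset hx, hxb⟩)
      have h3 := hcont.tendsto.comp
        (tendsto_nhdsWithin_iff.2 ⟨hlim, hU.mono fun s hs => A.subset hs⟩)
      refine tendsto_nhds_unique h3 (tendsto_const_nhds.congr' ?_)
      filter_upwards [hU] with s hs
      exact ((CkExt.ext_zero_apply f hs _).trans (hf _ hs (hZ x hxZ _))).symm
    obtain ⟨N, w, p, hp, hsum⟩ := hA.exists_cutoffExtend_eq_sum (F := F) c hz'
    refine (hsum (CkExt.ext f)).trans (Finset.sum_eq_zero fun j _ => ?_)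
    rcases eq_or_ne (w j) 0 with hw | hw
    · rw [hw, zero_smul]
    · obtain ⟨h1, h2, t, ht⟩ := hp j hw
      rw [hext _ h1 (ht ▸ hZ z hzZ t) h2, smul_zero]

end Operator

/-! ### Cubes -/

section Cubes

variable {n : ℕ} {E : Type*} [AddCommGroup E] [Module ℝ E] [TopologicalSpace E]

/-- The `i`-th coordinate of `ℝ^n`, as a functional on `ℝ^n × E`. -/
def coordCLM (E : Type*) [AddCommGroup E] [Module ℝ E]
    [TopologicalSpace E] (i : Fin n) :
    ((Fin n → ℝ) × E) →L[ℝ] ℝ :=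
  (ContinuousLinearMap.proj (R := ℝ) (φ := fun _ : Fin n => ℝ) i).comp
    (ContinuousLinearMap.fst ℝ (Fin n → ℝ) E)

theorem coordCLM_apply (i : Fin n) (z : (Fin n → ℝ) × E) : coordCLM E i z = z.1 i := rfl

theorem cube_mono {a B B' : Fin n → EReal} (h : ∀ i, B i ≤ B' i) : cube a B ⊆ cube a B' :=
  pi_mono fun i _ _ hy => ⟨hy.1, hy.2.trans_le (h i)⟩

theorem cubec_mono {a B B' : Fin n → EReal} (h : ∀ i, B i ≤ B' i) : cubec a B ⊆ cubec a B' :=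
  pi_mono fun i _ _ hy => ⟨hy.1, hy.2.trans (h i)⟩

theorem isReflectable_cubePair (V : DomainPair E) {a B B' : Fin n → EReal} {i : Fin n} {τ b : ℝ}
    (haτ : a i < (τ : EReal)) (hτb : τ < b) (hB : B i = (b : EReal)) (hB' : B' i = ⊤)
    (hne : ∀ j, j ≠ i → B j = B' j) (h : ∀ j, a j < B j) (h' : ∀ j, a j < B' j) :
    IsReflectable ((cubePair a B h).prod V) ((cubePair a B' h').prod V) (coordCLM E i)
      (Pi.single i 1, 0) τ b where
  lam_e := by simp [coordCLM_apply]
  lt := hτb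
  mem_U z := by
    have hiff : z.1 ∈ cube a B ↔ z.1 ∈ cube a B' ∧ z.1 i < b := by
      refine ⟨fun hz => ⟨fun j _ => ?_, ?_⟩, fun hz j _ => ?_⟩
      · rcases eq_or_ne j i with rfl | hj
        · exact ⟨(hz j (mem_univ _)).1, by rw [hB']; exact EReal.coe_lt_top _⟩
        · exact ⟨(hz j (mem_univ _)).1, by rw [← hne j hj]; exact (hz j (mem_univ _)).2⟩
      · have h1 := (hz i (mem_univ _)).2
        rw [hB] at h1
        exact EReal.coe_lt_coe_iff.1 h1
      · rcases eq_or_ne j i with rfl | hj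
        · exact ⟨(hz.1 j (mem_univ _)).1, by rw [hB]; exact EReal.coe_lt_coe_iff.2 hz.2⟩
        · exact ⟨(hz.1 j (mem_univ _)).1, by rw [hne j hj]; exact (hz.1 j (mem_univ _)).2⟩
    change (z.1 ∈ cube a B ∧ z.2 ∈ V.U) ↔ (z.1 ∈ cube a B' ∧ z.2 ∈ V.U) ∧ z.1 i < b
    rw [hiff]
    tauto
  mem_CU z := by
    have hiff : z.1 ∈ cubec a B ↔ z.1 ∈ cubec a B' ∧ z.1 i ≤ b := by
      refine ⟨fun hz => ⟨fun j _ => ?_, ?_⟩, fun hz j _ => ?_⟩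
      · rcases eq_or_ne j i with rfl | hj
        · exact ⟨(hz j (mem_univ _)).1, by rw [hB']; exact le_top⟩
        · exact ⟨(hz j (mem_univ _)).1, by rw [← hne j hj]; exact (hz j (mem_univ _)).2⟩
      · have h1 := (hz i (mem_univ _)).2
        rw [hB] at h1
        exact EReal.coe_le_coe_iff.1 h1
      · rcases eq_or_ne j i with rfl | hj
        · exact ⟨(hz.1 j (mem_univ _)).1, by rw [hB]; exact EReal.coe_le_coe_iff.2 hz.2⟩
        · exact ⟨(hz.1 j (mem_univ _)).1, by rw [hne j hj]; exact (hz.1 j (mem_univ _)).2⟩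
    change (z.1 ∈ cubec a B ∧ z.2 ∈ V.CU) ↔ (z.1 ∈ cubec a B' ∧ z.2 ∈ V.CU) ∧ z.1 i ≤ b
    rw [hiff]
    tauto
  add_mem_U z hz t ht := by
    rw [coordCLM_apply] at ht
    refine ⟨fun j _ => ?_, by simpa using hz.2⟩
    rcases eq_or_ne j i with rfl | hj
    · refine ⟨haτ.trans_le ?_, by rw [hB']; exact EReal.coe_lt_top _⟩
      simpa using EReal.coe_le_coe_iff.2 ht
    · simpa [hj] using hz.1 j (mem_univ _)
  add_mem_CU z hz t ht := by
    rw [coordCLM_apply] at ht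
    refine ⟨fun j _ => ?_, by simpa using hz.2⟩
    rcases eq_or_ne j i with rfl | hj
    · refine ⟨haτ.trans_le ?_, by rw [hB']; exact le_top⟩
      simpa using EReal.coe_le_coe_iff.2 ht
    · simpa [hj] using hz.1 j (mem_univ _)

variable [IsTopologicalAddGroup E] [ContinuousSMul ℝ E]
  {F : Type*} [AddCommGroup F] [Module ℝ F] [TopologicalSpace F] [IsTopologicalAddGroup F]
  [ContinuousSMul ℝ F] [LocallyConvexSpace ℝ F] [T2Space F]

/-- Successive extension in the coordinates from a finite set `s`. -/
theorem exists_extension_cubePair (k : ℕ∞) (V : DomainPair E) {a : Fin n → EReal}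
    {τ b : Fin n → ℝ} (haτ : ∀ i, a i < (τ i : EReal)) (hτb : ∀ i, τ i < b i)
    (hab : ∀ i, a i < (b i : EReal)) (s : Finset (Fin n)) :
    ∀ (B : Fin n → EReal) (_ : ∀ i, B i = if i ∈ s then ⊤ else (b i : EReal))
      (hB : ∀ i, a i < B i),
      ∃ T : CkExt F k ((cubePair a (fun i => (b i : EReal)) hab).prod V) →ₗ[ℝ]
          CkExt F k ((cubePair a B hB).prod V),
        (∀ f z (hz : z ∈ ((cubePair a (fun i => (b i : EReal)) hab).prod V).U)
          (hz' : z ∈ ((cubePair a B hB).prod V).U), (T f).1 ⟨z, hz'⟩ = f.1 ⟨z, hz⟩) ∧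
        ∀ f z (hz' : z ∈ ((cubePair a B hB).prod V).U),
          (∃ i ∈ s, 2 * b i - τ i ≤ z.1 i) → (T f).1 ⟨z, hz'⟩ = 0 := by
  induction s using Finset.induction_on with
  | empty =>
    intro B hBs hB
    obtain rfl : B = fun i => (b i : EReal) := funext fun i => by simpa using hBs i
    exact ⟨LinearMap.id, fun f z hz hz' => rfl, fun f z hz' ⟨i, hi, _⟩ => by simp at hi⟩
  | insert i s his ih =>
    intro B hBs hB
    set B₀ : Fin n → EReal := fun j => if j ∈ s then ⊤ else (b j : EReal) with hB₀s
    have hle : ∀ j, (b j : EReal) ≤ B₀ j := fun j => by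
      simp only [hB₀s]
      split_ifs
      · exact le_top
      · exact le_rfl
    have hB₀ : ∀ j, a j < B₀ j := fun j => (hab j).trans_le (hle j)
    obtain ⟨T₁, hT₁, hT₁0⟩ := ih B₀ (fun j => rfl) hB₀
    have hA := isReflectable_cubePair V (haτ i) (hτb i) (B := B₀) (B' := B) (if_neg his)
      (by rw [hBs i, if_pos (Finset.mem_insert_self i s)])
      (fun j hj => by rw [hBs j]; simp [hB₀s, hj]) hB₀ hB
    obtain ⟨T₂, hT₂, hT₂0, hT₂Z⟩ := hA.exists_extension (F := F) k
    refine ⟨T₂ ∘ₗ T₁, fun f z hz hz' => ?_, fun f z hz' hi => ?_⟩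
    · have hz₀ : z ∈ ((cubePair a B₀ hB₀).prod V).U := ⟨cube_mono hle hz.1, hz.2⟩
      exact (hT₂ (T₁ f) z hz₀ hz').trans (hT₁ f z hz hz₀)
    · obtain ⟨j, hj, hzj⟩ := hi
      rcases Finset.mem_insert.1 hj with rfl | hjs
      · exact hT₂0 (T₁ f) z hz' hzj
      · have hji : j ≠ i := fun h => his (h ▸ hjs)
        refine hT₂Z (T₁ f) {x | 2 * b j - τ j ≤ x.1 j} (fun x hx t => ?_)
          (fun x hx hxj => hT₁0 f x hx ⟨j, hjs, hxj⟩) z hz' hzj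
        have hx' : 2 * b j - τ j ≤ x.1 j := hx
        show 2 * b j - τ j ≤ (x + t • ((Pi.single i 1, 0) : (Fin n → ℝ) × E)).1 j
        simpa [hji] using hx'

end Cubes

end Bastiani

end

/-! ### The extension theorem -/

theorem mainTheorem2
    {F : Type*} [AddCommGroup F] [Module ℝ F] [TopologicalSpace F] [IsTopologicalAddGroup F]
    [ContinuousSMul ℝ F] [LocallyConvexSpace ℝ F] [T2Space F]
    (k : ℕ∞)
    {E : Type*} [AddCommGroup E] [Module ℝ E] [TopologicalSpace E] [IsTopologicalAddGroup E]
    [ContinuousSMul ℝ E] [LocallyConvexSpace ℝ E] [T2Space E]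
    (V : Bastiani.DomainPair E)
    (n : ℕ) (hn : 1 ≤ n) (a : Fin n → EReal) (τ b : Fin n → ℝ)
    (haτ : ∀ i, a i < (τ i : EReal)) (hτb : ∀ i, τ i < b i) :
    ∃ Ext :
      Bastiani.CkExt F k ((Bastiani.cubePair a (fun i => (b i : EReal))
        (fun i => (haτ i).trans (EReal.coe_lt_coe_iff.2 (hτb i)))).prod V) →ₗ[ℝ]
      Bastiani.CkExt F k ((Bastiani.cubePair a (fun _ => (⊤ : EReal))
        (fun i => (haτ i).trans (EReal.coe_lt_top (τ i)))).prod V),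
      (∀ f, ∀ ℓ : ℕ, (ℓ : ℕ∞) ≤ k →
        ∀ y ∈ Bastiani.cubec a (fun i => (b i : EReal)), ∀ x ∈ V.CU,
        ∀ w : Fin ℓ → (Fin n → ℝ) × E,
          Bastiani.CkExt.ext (Ext f) ℓ (y, x) w = Bastiani.CkExt.ext f ℓ (y, x) w) ∧
      (∀ y ∈ Bastiani.cube a (fun _ => (⊤ : EReal)), (∃ i, 2 * b i - τ i ≤ y i) →
        ∀ f, ∀ ℓ : ℕ, (ℓ : ℕ∞) ≤ k → ∀ x ∈ V.CU,
        ∀ w : Fin ℓ → (Fin n → ℝ) × E,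
          Bastiani.CkExt.ext (Ext f) ℓ (y, x) w = 0) := by
  have hab : ∀ i, a i < (b i : EReal) := fun i =>
    (haτ i).trans (EReal.coe_lt_coe_iff.2 (hτb i))
  set A := (Bastiani.cubePair a (fun i => (b i : EReal)) hab).prod V
  set A' := (Bastiani.cubePair a (fun _ => (⊤ : EReal))
    (fun i => (haτ i).trans (EReal.coe_lt_top (τ i)))).prod V
  obtain ⟨T, hT, hT0⟩ := Bastiani.exists_extension_cubePair (F := F) k V haτ hτb hab Finset.univ
    (fun _ => (⊤ : EReal)) (fun i => by simp) (fun i => (haτ i).trans (EReal.coe_lt_top (τ i)))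
  have hU : A.U ⊆ A'.U := prod_mono (Bastiani.cube_mono fun i => le_top) subset_rfl
  have hCU : A.CU ⊆ A'.CU := prod_mono (Bastiani.cubec_mono fun i => le_top) subset_rfl
  refine ⟨T, fun f ℓ hℓ y hy x hx w => ?_, fun y hy hi f ℓ hℓ x hx w => ?_⟩
  · refine ((Bastiani.CkExt.isJet (T f)).mono hU hCU).eq_of_eq_zero (Bastiani.CkExt.isJet f) A.isOpen A.subset A.subset_closure
      isOpen_univ (fun z hz v => ?_) hℓ
      (show (y, x) ∈ A.CU ∩ univ from ⟨⟨hy, hx⟩, mem_univ _⟩) w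
    rw [Bastiani.CkExt.ext_zero_apply _ (hU hz.1), Bastiani.CkExt.ext_zero_apply _ hz.1]
    exact hT f z hz.1 (hU hz.1)
  · obtain ⟨i, hi⟩ := hi
    -- the extended differential vanishes on the open part of the region in question
    have hopen : ∀ z ∈ A'.CU, 2 * b i - τ i < z.1 i →
        Bastiani.CkExt.ext (T f) ℓ z w = 0 := fun z hz hzi =>
      (Bastiani.CkExt.isJet (T f)).eq_of_eq_zero (Bastiani.isJet_zero k A'.U A'.CU) A'.isOpen A'.subset
        A'.subset_closure (O := {z | 2 * b i - τ i < z.1 i})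
        (isOpen_lt continuous_const (by fun_prop))
        (fun z hz v => (Bastiani.CkExt.ext_zero_apply _ hz.1 v).trans
          (hT0 f z hz.1 ⟨i, Finset.mem_univ i, le_of_lt hz.2⟩)) hℓ ⟨hz, hzi⟩ w
    have hyx : (y, x) ∈ A'.CU := ⟨fun j hj => ⟨(hy j hj).1, le_top⟩, hx⟩
    -- moving up in the `i`-th coordinate leads into the open part
    have hmem : ∀ s : ℝ, 0 < s → (y + s • Pi.single i 1, x) ∈ A'.CU := by
      intro s hs
      refine ⟨fun j _ => ⟨(hy j (mem_univ _)).1.trans_le (EReal.coe_le_coe_iff.2 ?_), le_top⟩, hx⟩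
      rcases eq_or_ne j i with rfl | hj
      · simpa using hs.le
      · simp [hj]
    have hlim : Tendsto (fun s : ℝ => (y + s • Pi.single i (1 : ℝ), x)) (𝓝[>] 0)
        (𝓝[A'.CU] (y, x)) := by
      refine tendsto_nhdsWithin_iff.2 ⟨?_, ?_⟩
      · have h1 : Continuous fun s : ℝ => (y + s • Pi.single i (1 : ℝ), x) := by fun_prop
        have h2 := h1.tendsto 0
        rw [zero_smul, add_zero] at h2
        exact h2.mono_left nhdsWithin_le_nhds
      · filter_upwards [self_mem_nhdsWithin] with s hs
        exact hmem s hs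
    refine tendsto_nhds_unique
      (((Bastiani.CkExt.isJet (T f)).continuousOn_apply hℓ w (y, x) hyx).tendsto.comp hlim)
      (tendsto_const_nhds.congr' ?_)
    filter_upwards [self_mem_nhdsWithin] with s hs
    refine (hopen _ (hmem s hs) ?_).symm
    have hs' : (0 : ℝ) < s := hs
    simpa using by linarith
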